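/- Let $q$ be an odd prime power. For an irreducible polynomial $F\in\mathbb F_q[T]$ of degree $r$ and $x\in\mathbb F_q[T]$, let $\deg_F x$ denote the degree of the unique polynomial of degree less than $r$ that is congruent to $x$ modulo $F$ (with $\deg 0=-\infty$). For a non-negative integer $m\le r$ let $E^{\sqrt{}}_{F,4}(\mathbf 1_m)$ be the number of tuples $(x_1,\dots,x_8)\in\mathbb F_q[T]^8$ with $\deg x_i<r$ and $\deg_F(x_i^2)<m$ for all $i$, and $$x_1+x_2+x_3+x_4\equiv x_5+x_6+x_7+x_8 \pmod F;$$ equivalently, it is the weighted energy $\sum \alpha(x_1^2)\overline{\alpha(x_2^2)}\cdots\alpha(x_7^2)\overline{\alpha(x_8^2)}$, over all $(x_1,\dots,x_8)$ with $\deg x_i<r$ that satisfy this congruence, of the characteristic function $\alpha=\mathbf 1_m$ of the set of residues $x$ modulo $F$ with $\deg_F x<m$. Then $$E^{\sqrt{}}_{F,4}(\mathbf 1_m)\le q^{6m+o(m)}\left(q^{11m/2-r/2}+q^{3m-r/4}+q^{5m/8-r/8}\right)+q^{5m+o(m)},$$ where $o(m)$ denotes a function of $m$ which may depend on $q$, but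 not on $r$ or $F$, and whose quotient by $m$ tends to $0$ as $m\to\infty$. Moreover, for $0<m<r/12$ the exponents in this bound improve on those in the bound $q^{4m+o(m)}\left(q^{7m/2-r/2}+q^{2m}\right)$ for the same quantity: $$\max\left\{6m+\max\left\{\tfrac{11m}{2}-\tfrac r2,\;3m-\tfrac r4,\;\tfrac{5m}{8}-\tfrac r8\right\},\;5m\right\}<4m+\max\left\{\tfrac{7m}{2}-\tfrac r2,\;2m\right\}.$$ -/

import Mathlib

open Polynomial Filter Asymptotics

namespace ModularRoots

noncomputable section

/-- The set of polynomials over `K` of degree smaller than `m` (the zero polynomial has degree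
`⊥`, so it always belongs to this set). -/
def shortPolys (K : Type*) [Field K] (m : ℕ) : Set K[X] :=
  {x | x.degree < (m : WithBot ℕ)}

/-- The residue ring `K[T]/⟨F⟩`. -/
abbrev Residues {K : Type*} [Field K] (F : K[X]) : Type _ :=
  K[X] ⧸ Ideal.span {F}

/-- The quotient map `K[T] → K[T]/⟨F⟩`. -/
abbrev residue {K : Type*} [Field K] (F : K[X]) : K[X] →+* Residues F :=
  Ideal.Quotient.mk (Ideal.span {F})

/-- `deg_F x`: the degree of the representative of `x` modulo `F` of degree less than `deg F`. -/
def degMod {K : Type*} [Field K] (F x : K[X]) : WithBot ℕ :=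
  (x % F).degree

/-- The tuples `(x₁, …, x₂ₖ)` of polynomials of degree less than `deg F` with
`x₁ + ⋯ + xₖ ≡ xₖ₊₁ + ⋯ + x₂ₖ` modulo `F`; the indices here start at `0`. -/
def energyTuples {K : Type*} [Field K] (F : K[X]) (k : ℕ) : Set (Fin (2 * k) → K[X]) :=
  {x | (∀ i, x i ∈ shortPolys K F.natDegree) ∧
    residue F (∑ i with i.val < k, x i) = residue F (∑ i with k ≤ i.val, x i)}

/-- The weighted energy of modular square roots: the sum over the tuples of `energyTuples F k` of
`α(x₁²) conj(α(x₂²)) ⋯ α(x₂ₖ₋₁²) conj(α(x₂ₖ²))`. The set of tuples is finite when `K` is, so that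
the `finsum` is then a genuine finite sum. -/
def sqrtEnergy {K 𝕜 : Type*} [Field K] [RCLike 𝕜] (F : K[X]) (k : ℕ) (α : Residues F → 𝕜) : 𝕜 :=
  ∑ᶠ x ∈ energyTuples F k, ∏ i : Fin (2 * k),
    if Even i.val then α (residue F (x i ^ 2)) else star (α (residue F (x i ^ 2)))

/-- The characteristic function of the set of residues `x` with `deg_F x < m`. -/
def shortWeight {K : Type*} [Field K] (𝕜 : Type*) [RCLike 𝕜] (F : K[X]) (m : ℕ) :
    Residues F → 𝕜 :=
  Set.indicator (residue F '' {x | degMod F x < (m : WithBot ℕ)}) 1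

theorem residue_eq_iff {K : Type*} [Field K] (F x y : K[X]) :
    residue F x = residue F y ↔ x % F = y % F := by
  rw [Ideal.Quotient.mk_eq_mk_iff_sub_mem, Ideal.mem_span_singleton]
  constructor
  · intro h
    rw [← sub_eq_zero, ← Polynomial.sub_mod]
    exact (EuclideanDomain.mod_eq_zero).2 h
  · intro h
    rw [← EuclideanDomain.mod_eq_zero, Polynomial.sub_mod, h, sub_self]

theorem residue_mem_iff {K : Type*} [Field K] (F x : K[X]) (m : ℕ) :
    residue F x ∈ residue F '' {x | degMod F x < (m : WithBot ℕ)} ↔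
      degMod F x < (m : WithBot ℕ) := by
  constructor
  · rintro ⟨y, hy, hxy⟩
    have h := (residue_eq_iff F y x).1 hxy
    change (y % F).degree < (m : WithBot ℕ) at hy
    rwa [h] at hy
  · intro h
    exact ⟨x, h, rfl⟩

theorem finite_shortPolys (K : Type*) [Field K] [Finite K] (m : ℕ) :
    (shortPolys K m).Finite := by
  have h : Finite (degreeLT K m) := Finite.of_equiv _ (degreeLTEquiv K m).toEquiv.symm
  refine (Set.toFinite (degreeLT K m : Set K[X])).subset fun x hx => ?_
  exact mem_degreeLT.2 hx

theorem finite_energyTuples {K : Type*} [Field K] [Finite K] (F : K[X]) (k : ℕ) :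
    (energyTuples F k).Finite := by
  refine (Set.Finite.pi' fun _ : Fin (2 * k) => finite_shortPolys K F.natDegree).subset ?_
  intro x hx
  exact hx.1

/-- For the characteristic function of `deg_F x < m`, the energy is the number of tuples all of
whose entries satisfy `deg_F (xᵢ²) < m`. -/
theorem sqrtEnergy_shortWeight {K : Type*} [Field K] [Finite K] (𝕜 : Type*) [RCLike 𝕜]
    (F : K[X]) (k m : ℕ) :
    sqrtEnergy F k (shortWeight 𝕜 F m) =
      (({x ∈ energyTuples F k | ∀ i, degMod F (x i ^ 2) < (m : WithBot ℕ)}).ncard : 𝕜) := by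
  classical
  have hprod : ∀ x : Fin (2 * k) → K[X], (∏ i : Fin (2 * k),
      if Even i.val then shortWeight 𝕜 F m (residue F (x i ^ 2))
        else star (shortWeight 𝕜 F m (residue F (x i ^ 2)))) =
      if ∀ i, degMod F (x i ^ 2) < (m : WithBot ℕ) then (1 : 𝕜) else 0 := by
    intro x
    trans ∏ i : Fin (2 * k), if degMod F (x i ^ 2) < (m : WithBot ℕ) then (1 : 𝕜) else 0
    · refine Finset.prod_congr rfl fun i _ => ?_
      by_cases h : degMod F (x i ^ 2) < (m : WithBot ℕ)
      · have h1 : shortWeight 𝕜 F m (residue F (x i ^ 2)) = 1 := by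
          rw [shortWeight, Set.indicator_of_mem ((residue_mem_iff F _ m).2 h)]
          rfl
        rw [h1, if_pos h]
        simp
      · have h1 : shortWeight 𝕜 F m (residue F (x i ^ 2)) = 0 := by
          rw [shortWeight, Set.indicator_of_notMem (mt (residue_mem_iff F _ m).1 h)]
        rw [h1, if_neg h]
        simp
    · rw [Fintype.prod_ite_zero, Finset.prod_const_one]
      congr
  rw [sqrtEnergy]
  simp_rw [hprod]
  rw [finsum_mem_eq_finite_toFinset_sum _ (finite_energyTuples F k), Finset.sum_ite,
    Finset.sum_const_zero, add_zero, Finset.sum_const, nsmul_eq_mul, mul_one,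
    ← Set.ncard_coe_finset]
  congr 2
  ext x
  simp

end

end ModularRoots

/-! Reduction modulo `F` turns the count into the energy of fourfold sums of the set `X` of square
roots, in the field of residues, of polynomials of degree below `m`, where `|X| ≤ 2 q^m`. By
Cauchy–Schwarz (`energy_product_add_le`) one summand can be dropped at the cost of `|X|²`. For `r ≥
12 m` the question becomes how many triples of elements of `X` have a given sum `l`.

If `a² = n₁`, `b² = n₂`, `c² = n₃` and `a + b + c = l`, then `l²` is a root modulo `F` of the
quartic over `K[T]` with formal roots `(a ± b ± c)²`. It is short when `X` is given weight `m`, and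
irreducible if no `nᵢ nⱼ` is a square (`irreducible_quartic`). Two such quartics with the same `l`
differ by a short cubic vanishing at `l²`. Resultants make all cubics of weight below `s₀ = ⌈(r +
9m)/6⌉` proportional (`exists_smul_eq_smul`). Above `s₀`, each unit of weight adds at most two
dimensions off that line (`finrank_vanishingCubics_le`). A line carries at most four quartics, since
their coefficients satisfy `(4c₂ - c₃²)² = 64c₀` (`card_le_four`). Hence each `l` has `O(q^(2(4m -
s₀)))` nondegenerate triples, with the subtraction truncated at zero. Degenerate triples contribute
little, because only `O(m q^(m + 3))` pairs have `nᵢ nⱼ` a square.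

Three ranges finish the proof (`bound_of_integral_bounds`): the trivial bound `q^(7m)` for `r ≤ 9m`,
the analogous argument with pairs and quadratics, giving `q^(6m + o(m))`, for `9m < r < 12m`, and
the triples for `r ≥ 12m`. The summand `q^(5m/8 - r/8)` is never needed. -/

namespace ModularRoots

/-! ### The weighted degree, in which `X` has weight `m` -/

/-- The substitution `f(T, X) ↦ f(T, T ^ m X)`, followed by an exchange of the two variables. -/
noncomputable def twist (K : Type*) [Field K] (m : ℕ) : K[X][X] →+* K[X][X] :=
  eval₂RingHom (mapRingHom C) (C X * X ^ m)

/-- The degree in `T` of `f(T, T ^ m X)`. -/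
noncomputable def wdeg {K : Type*} [Field K] (m : ℕ) (f : K[X][X]) : ℕ :=
  (twist K m f).natDegree

section Twist

variable {K : Type*} [Field K] {m : ℕ}

theorem coeff_coeff_twist (f : K[X][X]) (t j : ℕ) :
    ((twist K m f).coeff t).coeff j =
      if j * m ≤ t then (f.coeff j).coeff (t - j * m) else 0 := by
  induction f using Polynomial.induction_on' with
  | add f g hf hg =>
    rw [map_add, coeff_add, coeff_add, hf, hg, coeff_add, coeff_add]
    split_ifs <;> simp
  | monomial n a =>
    have h : twist K m (monomial n a) = map C a * C (X ^ n) * X ^ (n * m) := by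
      simp only [twist, coe_eval₂RingHom, eval₂_monomial, coe_mapRingHom, map_pow]
      ring
    rw [h, coeff_mul_X_pow', coeff_monomial]
    by_cases hj : n = j
    · subst hj
      rw [if_pos rfl]
      split_ifs with h1
      · rw [coeff_mul_C, coeff_map, coeff_C_mul, coeff_X_pow_self, mul_one]
      · rw [coeff_zero]
    · rw [if_neg hj]
      simp only [coeff_zero, ite_self]
      split_ifs with h1
      · rw [coeff_mul_C, coeff_map, coeff_C_mul, coeff_X_pow, if_neg (Ne.symm hj), mul_zero]
      · rw [coeff_zero]

theorem coeff_coeff_twist_add (f : K[X][X]) (t j : ℕ) :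
    ((twist K m f).coeff (t + j * m)).coeff j = (f.coeff j).coeff t := by
  rw [coeff_coeff_twist, if_pos (Nat.le_add_left _ _), Nat.add_sub_cancel]

theorem twist_injective : Function.Injective (twist K m) := by
  rw [injective_iff_map_eq_zero]
  intro f hf
  ext j t
  rw [← coeff_coeff_twist_add (m := m), hf]
  simp

theorem twist_ne_zero {f : K[X][X]} (hf : f ≠ 0) : twist K m f ≠ 0 :=
  (map_ne_zero_iff _ twist_injective).2 hf

/-- Additivity is the reason for defining the weight through a substitution: it becomes an ordinary
degree over a domain. -/
theorem wdeg_mul {f g : K[X][X]} (hf : f ≠ 0) (hg : g ≠ 0) :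
    wdeg m (f * g) = wdeg m f + wdeg m g := by
  rw [wdeg, map_mul, natDegree_mul (twist_ne_zero hf) (twist_ne_zero hg), wdeg, wdeg]

theorem natDegree_coeff_add_le_wdeg (f : K[X][X]) {j : ℕ} (hj : f.coeff j ≠ 0) :
    (f.coeff j).natDegree + j * m ≤ wdeg m f := by
  apply le_natDegree_of_ne_zero
  intro h
  have := coeff_coeff_twist_add (m := m) f (f.coeff j).natDegree j
  rw [h, coeff_zero, eq_comm, coeff_natDegree, leadingCoeff_eq_zero] at this
  exact hj this

theorem natDegree_mul_le_wdeg {f : K[X][X]} (hf : f ≠ 0) : f.natDegree * m ≤ wdeg m f := by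
  have := natDegree_coeff_add_le_wdeg (m := m) f (j := f.natDegree)
    (by rwa [coeff_natDegree, Ne, leadingCoeff_eq_zero])
  omega

theorem wdeg_le {f : K[X][X]} {ρ : ℕ}
    (h : ∀ j, f.coeff j ≠ 0 → (f.coeff j).natDegree + j * m ≤ ρ) : wdeg m f ≤ ρ := by
  rw [wdeg, natDegree_le_iff_coeff_eq_zero]
  intro t ht
  ext j
  rw [coeff_coeff_twist, coeff_zero]
  split_ifs with h1
  · by_cases hj : f.coeff j = 0
    · simp [hj]
    · refine coeff_eq_zero_of_natDegree_lt ?_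
      have := h j hj
      omega
  · rfl

/-- The right-hand side is linear in `f` and also admits `f = 0`, so it can define a subspace. -/
theorem wdeg_lt_iff {f : K[X][X]} (hf : f ≠ 0) {s : ℕ} :
    wdeg m f < s ↔ ∀ j t, s ≤ t + j * m → (f.coeff j).coeff t = 0 := by
  constructor
  · intro h j t hs
    rw [← coeff_coeff_twist_add (m := m)]
    rw [coeff_eq_zero_of_natDegree_lt (lt_of_lt_of_le h hs), coeff_zero]
  · intro h
    by_contra hs
    have h1 : (twist K m f).coeff (wdeg m f) = 0 := by
      ext j
      rw [coeff_coeff_twist, coeff_zero]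
      split_ifs with h1
      · apply h
        omega
      · rfl
    rw [wdeg, coeff_natDegree, leadingCoeff_eq_zero] at h1
    exact twist_ne_zero hf h1

end Twist

/-! ### Determinants and resultants -/

section Determinant

variable {K L : Type*} [Field K] [Field L] {m r : ℕ} {φ : K[X] →+* L}

/-- Independent polynomials over `K[T]` which share a root modulo a polynomial of degree `r` cannot
all be small. -/
theorem add_le_sum_wdeg (hφ : ∀ a, φ a = 0 → a ≠ 0 → r ≤ a.natDegree) {n : ℕ} (hn : 0 < n)
    (h : Fin n → K[X][X]) (hdeg : ∀ i, (h i).natDegree < n) (z : L)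
    (hz : ∀ i, eval₂ φ z (h i) = 0)
    (hli : ∀ c : Fin n → K[X], ∑ i, C (c i) * h i = 0 → c = 0) :
    r + m * ∑ j : Fin n, (j : ℕ) ≤ ∑ i, wdeg m (h i) := by
  set N : Matrix (Fin n) (Fin n) K[X] := Matrix.of fun i j => (h i).coeff j with hN
  have hdet : N.det ≠ 0 := by
    intro h0
    obtain ⟨c, hc, hc0⟩ := Matrix.exists_vecMul_eq_zero_iff.2 h0
    refine hc (hli c ?_)
    ext1 j
    rw [finsetSum_coeff, coeff_zero]
    by_cases hj : j < n
    · have := congrFun hc0 ⟨j, hj⟩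
      simpa [Matrix.vecMul, dotProduct, hN] using this
    · refine Finset.sum_eq_zero fun i _ => ?_
      rw [coeff_C_mul, coeff_eq_zero_of_natDegree_lt (by have := hdeg i; omega), mul_zero]
  -- The powers of `z` form a nonzero kernel vector, whose entry at index `0` is `1`.
  have hdet0 : φ N.det = 0 := by
    rw [RingHom.map_det, ← Matrix.exists_mulVec_eq_zero_iff]
    refine ⟨fun j => z ^ (j : ℕ), fun h0 => ?_, ?_⟩
    · have := congrFun h0 ⟨0, hn⟩
      simp at this
    · ext i
      have := hz i
      rw [eval₂_eq_sum_range' φ (hdeg i), Finset.sum_range] at this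
      simpa [Matrix.mulVec, dotProduct, hN] using this
  have hr := hφ _ hdet0 hdet
  -- Scaling column `j` by `T^(jm)` bounds all entries of row `i` by the weight of `h i`.
  have hscale : (N * Matrix.diagonal fun j : Fin n => (X : K[X]) ^ (j * m : ℕ)).det =
      N.det * X ^ (m * ∑ j : Fin n, (j : ℕ)) := by
    rw [Matrix.det_mul, Matrix.det_diagonal, Finset.prod_pow_eq_pow_sum, Finset.mul_sum]
    simp_rw [mul_comm m]
  have hle : (N.det * X ^ (m * ∑ j : Fin n, (j : ℕ))).natDegree ≤ ∑ i, wdeg m (h i) := by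
    rw [← hscale, Matrix.det_apply]
    refine natDegree_sum_le_of_forall_le _ _ fun σ _ => ?_
    rw [Units.smul_def]
    refine (natDegree_smul_le _ _).trans ?_
    refine (natDegree_prod_le _ _).trans ?_
    rw [← Equiv.sum_comp σ (fun i => wdeg m (h i))]
    refine Finset.sum_le_sum fun i _ => ?_
    rw [Matrix.mul_diagonal, show N (σ i) i = (h (σ i)).coeff i from rfl]
    by_cases h0 : (h (σ i)).coeff i = 0
    · simp [h0]
    · refine le_trans ?_ (natDegree_coeff_add_le_wdeg _ h0)
      rw [natDegree_mul h0 (pow_ne_zero _ X_ne_zero), natDegree_X_pow]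
  rw [natDegree_mul hdet (pow_ne_zero _ X_ne_zero), natDegree_X_pow] at hle
  omega

/-- A lower bound for the sizes of relatively prime polynomials with a common root. -/
theorem add_mul_le_of_isRelPrime (hφ : ∀ a, φ a = 0 → a ≠ 0 → r ≤ a.natDegree) {f g : K[X][X]}
    (hf : f ≠ 0) (hg : g ≠ 0) (hfg : IsRelPrime f g) (hpos : 0 < f.natDegree + g.natDegree) {z : L}
    (hzf : eval₂ φ z f = 0) (hzg : eval₂ φ z g = 0) :
    r + m * (f.natDegree * g.natDegree) ≤
      g.natDegree * wdeg m f + f.natDegree * wdeg m g := by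
  set a := f.natDegree with ha
  set b := g.natDegree with hb
  have hX : ∀ i : ℕ, wdeg m ((X : K[X][X]) ^ i) ≤ i * m := by
    intro i
    refine wdeg_le fun j hj => ?_
    rw [coeff_X_pow] at hj ⊢
    split_ifs at hj ⊢ with hji
    · simp [hji]
    · exact absurd rfl hj
  -- These are the rows of the Sylvester matrix. The shifts by powers of `X` cancel against the sum
  -- of column indices and leave the term `m a b`.
  have key := add_le_sum_wdeg (m := m) hφ (n := b + a) (by omega)
    (Fin.addCases (fun i : Fin b => X ^ (i : ℕ) * f) (fun i : Fin a => X ^ (i : ℕ) * g)) ?_ z ?_ ?_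
  · rw [Fin.sum_univ_add, Fin.sum_univ_add] at key
    simp only [Fin.addCases_left, Fin.addCases_right, Fin.val_castAdd, Fin.val_natAdd] at key
    have h1 : ∑ i : Fin b, wdeg m (X ^ (i : ℕ) * f) ≤ m * ∑ i : Fin b, (i : ℕ) + b * wdeg m f := by
      calc _ ≤ ∑ i : Fin b, (m * (i : ℕ) + wdeg m f) := by
            refine Finset.sum_le_sum fun i _ => ?_
            rw [wdeg_mul (pow_ne_zero _ X_ne_zero) hf, mul_comm]
            exact Nat.add_le_add_right (hX _) _
        _ = _ := by rw [Finset.sum_add_distrib, Finset.mul_sum]; simp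
    have h2 : ∑ i : Fin a, wdeg m (X ^ (i : ℕ) * g) ≤ m * ∑ i : Fin a, (i : ℕ) + a * wdeg m g := by
      calc _ ≤ ∑ i : Fin a, (m * (i : ℕ) + wdeg m g) := by
            refine Finset.sum_le_sum fun i _ => ?_
            rw [wdeg_mul (pow_ne_zero _ X_ne_zero) hg, mul_comm]
            exact Nat.add_le_add_right (hX _) _
        _ = _ := by rw [Finset.sum_add_distrib, Finset.mul_sum]; simp
    rw [Finset.sum_add_distrib] at key
    simp only [Finset.sum_const, Finset.card_univ, Fintype.card_fin, smul_eq_mul] at key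
    nlinarith [key, h1, h2]
  · intro i
    refine Fin.addCases (fun i => ?_) (fun i => ?_) i
    · rw [Fin.addCases_left, natDegree_mul (pow_ne_zero _ X_ne_zero) hf, natDegree_X_pow]
      omega
    · rw [Fin.addCases_right, natDegree_mul (pow_ne_zero _ X_ne_zero) hg, natDegree_X_pow]
      omega
  · intro i
    refine Fin.addCases (fun i => ?_) (fun i => ?_) i
    · rw [Fin.addCases_left, eval₂_mul, hzf, mul_zero]
    · rw [Fin.addCases_right, eval₂_mul, hzg, mul_zero]
  · intro c hc
    rw [Fin.sum_univ_add] at hc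
    simp only [Fin.addCases_left, Fin.addCases_right] at hc
    set p : K[X][X] := ∑ i : Fin b, C (c (Fin.castAdd a i)) * X ^ (i : ℕ) with hp
    set q : K[X][X] := ∑ i : Fin a, C (c (Fin.natAdd b i)) * X ^ (i : ℕ) with hq
    have hpq : p * f + q * g = 0 := by
      rw [← hc, hp, hq, Finset.sum_mul, Finset.sum_mul]
      simp_rw [mul_assoc]
    have hq0 : q = 0 := by
      have hdvd : f ∣ q := by
        refine hfg.dvd_of_dvd_mul_right ⟨-p, ?_⟩
        linear_combination hpq
      by_contra hne
      have := degree_le_of_dvd hdvd hne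
      refine absurd this (not_le.2 ?_)
      rw [degree_eq_natDegree hf, ← ha]
      exact degree_sum_fin_lt _
    have hp0 : p = 0 := by
      rw [hq0, zero_mul, add_zero] at hpq
      exact (mul_eq_zero.1 hpq).resolve_right hf
    have hcoef : ∀ (n : ℕ) (d : Fin n → K[X]), ∑ i : Fin n, C (d i) * (X : K[X][X]) ^ (i : ℕ) = 0 →
        ∀ i, d i = 0 := by
      intro n d hd i
      have := congrArg (fun P => coeff P (i : ℕ)) hd
      simpa [finsetSum_coeff, coeff_C_mul, coeff_X_pow, Fin.val_inj] using this
    funext i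
    refine Fin.addCases (fun i => ?_) (fun i => ?_) i
    · exact hcoef b _ hp0 i
    · exact hcoef a _ hq0 i

end Determinant

/-! ### The quartic with roots `(a ± b ± c)²` and its irreducibility -/

section Quartic

variable {K : Type*} [Field K]

/-- If `p = a² + b² + c²`, `u = p² - 4 (a²b² + a²c² + b²c²)` and `e = a²b²c²`, then the roots of this
polynomial are the squares `(a ± b ± c)²`. -/
noncomputable def quartic (p u e : K[X]) : K[X][X] :=
  X ^ 4 + C (-4 * p) * X ^ 3 + C (4 * p ^ 2 + 2 * u) * X ^ 2 + C (-(4 * p * u + 64 * e)) * X +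
    C (u ^ 2)

theorem coeff_quartic_form {R : Type*} [CommRing R] (a b c d : R) (j : ℕ) :
    (X ^ 4 + C a * X ^ 3 + C b * X ^ 2 + C c * X + C d : R[X]).coeff j =
      match j with | 0 => d | 1 => c | 2 => b | 3 => a | 4 => 1 | _ => 0 := by
  have h : (X ^ 4 + C a * X ^ 3 + C b * X ^ 2 + C c * X + C d : R[X]) =
      X ^ 4 + C a * X ^ 3 + C b * X ^ 2 + C c * X ^ 1 + C d * X ^ 0 := by simp
  rw [h]
  simp only [coeff_add, coeff_C_mul, coeff_X_pow]
  match j with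
  | 0 => simp
  | 1 => simp
  | 2 => simp
  | 3 => simp
  | 4 => simp
  | n + 5 => simp

theorem monic_quartic (p u e : K[X]) : (quartic p u e).Monic := by
  unfold quartic
  monicity!

theorem natDegree_quartic (p u e : K[X]) : (quartic p u e).natDegree = 4 := by
  unfold quartic
  compute_degree!

theorem eval₂_quartic {S : Type*} [CommRing S] (φ : K[X] →+* S) {n₁ n₂ n₃ : K[X]} {a b c : S}
    (ha : a ^ 2 = φ n₁) (hb : b ^ 2 = φ n₂) (hc : c ^ 2 = φ n₃) :
    eval₂ φ ((a + b + c) ^ 2) (quartic (n₁ + n₂ + n₃)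
      ((n₁ + n₂ + n₃) ^ 2 - 4 * (n₁ * n₂ + n₁ * n₃ + n₂ * n₃)) (n₁ * n₂ * n₃)) = 0 := by
  simp only [quartic, eval₂_add, eval₂_mul, eval₂_C, eval₂_X_pow, eval₂_X]
  simp only [map_neg, map_mul, map_add, map_pow, map_sub, map_ofNat, ← ha, ← hb, ← hc]
  ring

/-- `K[T]` is integrally closed, so `g² ∣ h²` forces `g ∣ h`. -/
theorem isSquare_of_mul_sq {c g h : K[X]} (hg : g ≠ 0) (h1 : c * g ^ 2 = h ^ 2) : IsSquare c := by
  have hd : g ∣ h := (IsIntegrallyClosed.pow_dvd_pow_iff two_ne_zero).1 ⟨c, by rw [← h1, mul_comm]⟩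
  obtain ⟨k, rfl⟩ := hd
  refine ⟨k, mul_right_cancel₀ (pow_ne_zero 2 hg) ?_⟩
  rw [h1]
  ring

theorem isSquare_of_four_mul (h2 : (2 : K) ≠ 0) {a b : K[X]} (h : 4 * a = b ^ 2) : IsSquare a := by
  have h4 : (2 : K[X]) ≠ 0 := by
    intro h0
    exact h2 (by simpa using congrArg (fun P => coeff P 0) h0)
  refine isSquare_of_mul_sq h4 (h := b) ?_
  rw [← h]
  ring

/-- Formally `t = ab + ac + bc` for a root `(a + b + c)²`. Multiplied by `n₂ n₃`, the equation
exhibits `n₂ n₃` times a square as a square, so that both squares must vanish. -/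
theorem eq_neg_of_not_isSquare (h2 : (2 : K) ≠ 0) {n₁ n₂ n₃ t : K[X]}
    (ht : (t ^ 2 - (n₁ * n₂ + n₁ * n₃ + n₂ * n₃)) ^ 2 =
      4 * (n₁ * n₂ * n₃) * (n₁ + n₂ + n₃ + 2 * t)) (h : ¬ IsSquare (n₂ * n₃)) : t = -n₁ := by
  have h2' : (2 : K[X]) ≠ 0 := by
    intro h0
    exact h2 (by simpa using congrArg (fun P => coeff P 0) h0)
  have key : n₂ * n₃ * (t ^ 2 + n₂ * n₃ - n₁ * n₂ - n₁ * n₃) ^ 2 =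
      (2 * (n₂ * n₃ * (t + n₁))) ^ 2 := by
    linear_combination (n₂ * n₃) * ht
  have h0 : n₂ * n₃ ≠ 0 := by
    intro h0
    exact h (h0 ▸ IsSquare.zero)
  by_cases hG : t ^ 2 + n₂ * n₃ - n₁ * n₂ - n₁ * n₃ = 0
  · rw [hG, zero_pow two_ne_zero, mul_zero, eq_comm, sq_eq_zero_iff] at key
    have := ((mul_eq_zero.1 ((mul_eq_zero.1 key).resolve_left h2')).resolve_left h0)
    linear_combination this
  · exact absurd (isSquare_of_mul_sq hG key) h

/-- A linear factor would force `n₁ = n₂`. A factorization into quadratics would give a root of the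
cubic resolvent, whose roots are the `16 nᵢ nⱼ`, that is a square. -/
theorem irreducible_quartic (h2 : (2 : K) ≠ 0) {n₁ n₂ n₃ : K[X]} (h₁₂ : ¬ IsSquare (n₁ * n₂))
    (h₁₃ : ¬ IsSquare (n₁ * n₃)) (h₂₃ : ¬ IsSquare (n₂ * n₃)) :
    Irreducible (quartic (n₁ + n₂ + n₃)
      ((n₁ + n₂ + n₃) ^ 2 - 4 * (n₁ * n₂ + n₁ * n₃ + n₂ * n₃)) (n₁ * n₂ * n₃)) := by
  have h2' : (2 : K[X]) ≠ 0 := by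
    intro h0
    exact h2 (by simpa using congrArg (fun P => coeff P 0) h0)
  have hhalf : C (1 / 2 : K) * 2 = 1 := by
    rw [show (2 : K[X]) = C 2 from rfl, ← C_mul, one_div, inv_mul_cancel₀ h2, C_1]
  rw [(monic_quartic _ _ _).irreducible_iff_natDegree']
  refine ⟨fun h1 => ?_, fun f g hf hg hfg hdeg => ?_⟩
  · have := natDegree_quartic (n₁ + n₂ + n₃)
      ((n₁ + n₂ + n₃) ^ 2 - 4 * (n₁ * n₂ + n₁ * n₃ + n₂ * n₃)) (n₁ * n₂ * n₃)
    rw [h1, natDegree_one] at this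
    omega
  have hsum : f.natDegree + g.natDegree = 4 := by
    rw [← hf.natDegree_mul hg, hfg, natDegree_quartic]
  rw [natDegree_quartic, Finset.mem_Ioc] at hdeg
  obtain hg1 | hg2 : g.natDegree = 1 ∨ g.natDegree = 2 := by omega
  · have hroot : eval (-g.coeff 0) g = 0 := by
      have hX : g = X + C (g.coeff 0) := hg.eq_X_add_C hg1
      rw [hX]
      simp
    set κ := -g.coeff 0 with hκ
    have hev := congrArg (eval κ) hfg
    rw [eval_mul, hroot, mul_zero] at hev
    simp only [quartic, eval_add, eval_mul, eval_C, eval_X_pow, eval_X] at hev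
    -- From `(a + b + c)² = n₁ + n₂ + n₃ + 2t`.
    set t := C (1 / 2 : K) * (κ - (n₁ + n₂ + n₃)) with ht
    have hκt : κ = n₁ + n₂ + n₃ + 2 * t := by
      rw [ht]
      linear_combination (-(κ - (n₁ + n₂ + n₃))) * hhalf
    have hmain : (t ^ 2 - (n₁ * n₂ + n₁ * n₃ + n₂ * n₃)) ^ 2 =
        4 * (n₁ * n₂ * n₃) * (n₁ + n₂ + n₃ + 2 * t) := by
      rw [hκt] at hev
      refine mul_left_cancel₀ (pow_ne_zero 4 h2') ?_
      linear_combination -hev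
    have e1 := eq_neg_of_not_isSquare h2 hmain h₂₃
    have e2 := eq_neg_of_not_isSquare (n₁ := n₂) (n₂ := n₁) (n₃ := n₃) (t := t) h2
      (by linear_combination hmain) h₁₃
    have e3 : n₁ = n₂ := by
      rw [e1] at e2
      exact neg_injective e2
    exact h₁₂ ⟨n₂, by rw [e3]⟩
  · have hf2 : f.natDegree = 2 := by omega
    have hform : ∀ h : K[X][X], h.Monic → h.natDegree = 2 →
        h = X ^ 2 + C (h.coeff 1) * X + C (h.coeff 0) := by
      intro h hm hd
      have := hm.as_sum
      rw [hd, Finset.sum_range_succ, Finset.sum_range_one] at this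
      simp only [pow_zero, mul_one, pow_one] at this
      conv_lhs => rw [this]
      ring
    have hprod : f * g = X ^ 4 + C (f.coeff 1 + g.coeff 1) * X ^ 3 +
        C (f.coeff 0 + g.coeff 0 + f.coeff 1 * g.coeff 1) * X ^ 2 +
        C (f.coeff 1 * g.coeff 0 + f.coeff 0 * g.coeff 1) * X + C (f.coeff 0 * g.coeff 0) := by
      conv_lhs => rw [hform f hf hf2, hform g hg hg2]
      simp only [C_add, C_mul]
      ring
    rw [hprod, quartic] at hfg
    have c3 := congrArg (fun P => coeff P 3) hfg
    have c2 := congrArg (fun P => coeff P 2) hfg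
    have c1 := congrArg (fun P => coeff P 1) hfg
    have c0 := congrArg (fun P => coeff P 0) hfg
    simp only [coeff_quartic_form] at c3 c2 c1 c0
    generalize f.coeff 1 = b at c3 c2 c1 c0
    generalize f.coeff 0 = c at c3 c2 c1 c0
    generalize g.coeff 1 = b' at c3 c2 c1 c0
    generalize g.coeff 0 = c' at c3 c2 c1 c0
    -- The shift makes the two linear coefficients symmetric. Formally, grouping the roots `(a + b ±
    -- c)²` gives `β = -4ab`.
    obtain ⟨β, hβ⟩ : ∃ β, β = b + 2 * (n₁ + n₂ + n₃) := ⟨_, rfl⟩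
    have hb : b = β - 2 * (n₁ + n₂ + n₃) := by rw [hβ]; ring
    subst hb
    have hb' : b' = -β - 2 * (n₁ + n₂ + n₃) := by linear_combination c3
    subst hb'
    have hs : c + c' = 2 * ((n₁ + n₂ + n₃) ^ 2 - 4 * (n₁ * n₂ + n₁ * n₃ + n₂ * n₃)) + β ^ 2 := by
      linear_combination c2
    have hd : β * (c' - c) = 2 * (n₁ + n₂ + n₃) * β ^ 2 - 64 * (n₁ * n₂ * n₃) := by
      linear_combination c1 + 2 * (n₁ + n₂ + n₃) * hs
    have hdisc : (c' - c) ^ 2 = (2 * ((n₁ + n₂ + n₃) ^ 2 -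
        4 * (n₁ * n₂ + n₁ * n₃ + n₂ * n₃)) + β ^ 2) ^ 2 -
        4 * ((n₁ + n₂ + n₃) ^ 2 - 4 * (n₁ * n₂ + n₁ * n₃ + n₂ * n₃)) ^ 2 := by
      rw [← hs, ← c0]
      ring
    have hfac : (β ^ 2 - 16 * (n₁ * n₂)) * ((β ^ 2 - 16 * (n₁ * n₃)) *
        (β ^ 2 - 16 * (n₂ * n₃))) = 0 := by
      have h3 : (β * (c' - c)) ^ 2 = β ^ 2 * (c' - c) ^ 2 := by ring
      rw [hd, hdisc] at h3
      linear_combination -h3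
    have hsq : ∀ a : K[X], β ^ 2 - 16 * a = 0 → IsSquare a := by
      intro a ha
      refine isSquare_of_mul_sq (g := 4) (h := β) ?_ (by linear_combination -ha)
      rw [show (4 : K[X]) = 2 ^ 2 by norm_num]
      exact pow_ne_zero 2 h2'
    rcases mul_eq_zero.1 hfac with h | h
    · exact h₁₂ (hsq _ h)
    · rcases mul_eq_zero.1 h with h | h
      · exact h₁₃ (hsq _ h)
      · exact h₂₃ (hsq _ h)

end Quartic

/-! ### Short cubics with a common root are proportional -/

section Lines

variable {K L : Type*} [Field K] [Field L] {m r : ℕ} {φ : K[X] →+* L}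

theorem isRelPrime_of_irreducible {f g : K[X][X]} (hf : Irreducible f) (h : ¬ f ∣ g) :
    IsRelPrime f g :=
  hf.isRelPrime_iff_not_dvd.2 h

/-- Two short cubics which vanish at a root, modulo `F`, of a short irreducible quartic are
proportional as soon as one of them is short enough. -/
theorem exists_smul_eq_smul (hφ : ∀ a, φ a = 0 → a ≠ 0 → r ≤ a.natDegree) (hr : 12 * m ≤ r)
    {z : L} {D : K[X][X]} (hD : Irreducible D) (hD4 : D.natDegree = 4) (hDm : wdeg m D ≤ 4 * m)
    (hDz : eval₂ φ z D = 0) {v w : K[X][X]} (hv : v ≠ 0) (hw : w ≠ 0) (hv3 : v.natDegree ≤ 3)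
    (hw3 : w.natDegree ≤ 3) (hvm : wdeg m v < 4 * m) (hwm : wdeg m w < 4 * m)
    (hvz : eval₂ φ z v = 0) (hwz : eval₂ φ z w = 0)
    (hvw : 3 * wdeg m v + 3 * wdeg m w < r + 9 * m) :
    ∃ a b : K[X], a ≠ 0 ∧ C a * w = C b * v := by
  by_contra hne
  push Not at hne
  -- The root `z` belongs either to the common factor `g` or to both coprime cofactors.
  obtain ⟨v', w', g, hrel, rfl, rfl⟩ := UniqueFactorizationMonoid.exists_reduced_factors v hv w
  have hg : g ≠ 0 := left_ne_zero_of_mul hv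
  have hv' : v' ≠ 0 := right_ne_zero_of_mul hv
  have hw' : w' ≠ 0 := right_ne_zero_of_mul hw
  rw [wdeg_mul hg hv'] at hvm hvw
  rw [wdeg_mul hg hw'] at hwm hvw
  rw [natDegree_mul hg hv'] at hv3
  rw [natDegree_mul hg hw'] at hw3
  rw [eval₂_mul] at hvz hwz
  have hva : v'.natDegree * m ≤ wdeg m v' := natDegree_mul_le_wdeg hv'
  have hwb : w'.natDegree * m ≤ wdeg m w' := natDegree_mul_le_wdeg hw'
  have hpos : 0 < v'.natDegree + w'.natDegree := by
    by_contra h0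
    have h1 := eq_C_of_natDegree_eq_zero (p := v') (by omega)
    have h2 := eq_C_of_natDegree_eq_zero (p := w') (by omega)
    refine hne (v'.coeff 0) (w'.coeff 0) (fun h3 => hv' (by rw [h1, h3, C_0])) ?_
    rw [← h1, ← h2]
    ring
  by_cases hgz : eval₂ φ z g = 0
  -- The resultant of `D` and `g` gives `r ≤ 4 wdeg g`. A cofactor has positive degree in `X`, hence
  -- weight at least `m`, so `wdeg g < 3m`, against `12m ≤ r`.
  · have hgD : ¬ D ∣ g := by
      intro h
      have := natDegree_le_of_dvd h hg
      rw [hD4] at this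
      omega
    have key := add_mul_le_of_isRelPrime (m := m) hφ hD.ne_zero hg
      (isRelPrime_of_irreducible hD hgD) (by omega) hDz hgz
    rw [hD4] at key
    have h1 : g.natDegree * wdeg m D ≤ g.natDegree * (4 * m) := Nat.mul_le_mul_left _ hDm
    have h2 : m ≤ wdeg m v' ∨ m ≤ wdeg m w' := by
      rcases Nat.eq_zero_or_pos v'.natDegree with h | h
      · right
        have : 1 * m ≤ w'.natDegree * m := Nat.mul_le_mul_right _ (by omega)
        omega
      · left
        have : 1 * m ≤ v'.natDegree * m := Nat.mul_le_mul_right _ h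
        omega
    have h3 : m * (4 * g.natDegree) = g.natDegree * (4 * m) := by ring
    rcases h2 with h2 | h2 <;> omega
  · have hvz' := (mul_eq_zero.1 hvz).resolve_left hgz
    have hwz' := (mul_eq_zero.1 hwz).resolve_left hgz
    have key := add_mul_le_of_isRelPrime (m := m) hφ hv' hw' hrel hpos hvz' hwz'
    have ha : v'.natDegree ≤ 3 := by omega
    have hb : w'.natDegree ≤ 3 := by omega
    generalize v'.natDegree = a at *
    generalize w'.natDegree = b at *
    generalize wdeg m v' = α at *
    generalize wdeg m w' = β at *
    -- If both degrees are at most `2`, or one is `0`, weights below `4m` contradict `12m ≤ r`.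
    -- Otherwise some degree is `3`, and `hvw` with the lower bounds `hva`, `hwb` gives the
    -- contradiction.
    interval_cases a <;> interval_cases b <;> omega

theorem wdeg_le_of_natDegree_coeff_le {f : K[X][X]} {μ d : ℕ}
    (h : ∀ j, (f.coeff j).natDegree ≤ (d - j) * μ) (hd : f.natDegree ≤ d) (hμ : μ ≤ m) :
    wdeg m f ≤ d * m := by
  refine wdeg_le fun j hj => ?_
  have h1 : j ≤ d := (le_natDegree_of_ne_zero hj).trans hd
  have h2 : (d - j) * μ ≤ (d - j) * m := Nat.mul_le_mul_left _ hμ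
  have h3 : (d - j) * m + j * m = d * m := by rw [← add_mul, Nat.sub_add_cancel h1]
  have := h j
  omega

theorem natDegree_coeff_quartic_le {p u e : K[X]} {μ : ℕ} (hp : p.natDegree ≤ μ)
    (hu : u.natDegree ≤ 2 * μ) (he : e.natDegree ≤ 3 * μ) (j : ℕ) :
    ((quartic p u e).coeff j).natDegree ≤ (4 - j) * μ := by
  rw [quartic, coeff_quartic_form]
  match j with
  | 0 => simpa using (natDegree_pow_le_of_le 2 hu).trans (by omega)
  | 1 =>
    change (-(4 * p * u + 64 * e)).natDegree ≤ _
    rw [natDegree_neg]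
    refine natDegree_add_le_of_degree_le ?_ ?_
    · refine (natDegree_mul_le_of_le (m := μ) ((natDegree_mul_le_of_le (m := 0) ?_ hp).trans
        (by omega)) hu).trans (by omega)
      exact (natDegree_ofNat 4).le
    · refine (natDegree_mul_le_of_le (m := 0) ?_ he).trans (by omega)
      exact (natDegree_ofNat 64).le
  | 2 =>
    refine natDegree_add_le_of_degree_le ?_ ?_
    · refine (natDegree_mul_le_of_le (m := 0) ?_ (natDegree_pow_le_of_le 2 hp)).trans (by omega)
      exact (natDegree_ofNat 4).le
    · refine (natDegree_mul_le_of_le (m := 0) ?_ hu).trans (by omega)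
      exact (natDegree_ofNat 2).le
  | 3 =>
    refine (natDegree_mul_le_of_le (m := 0) ?_ hp).trans (by omega)
    rw [natDegree_neg]
    exact (natDegree_ofNat 4).le
  | 4 => simp
  | n + 5 => simp

/-- The polynomial whose roots are `(a ± b)²`, where `a ^ 2 = n₁` and `b ^ 2 = n₂`. -/
noncomputable def quadratic (n₁ n₂ : K[X]) : K[X][X] :=
  X ^ 2 + C (-2 * (n₁ + n₂)) * X + C ((n₁ - n₂) ^ 2)

theorem monic_quadratic (n₁ n₂ : K[X]) : (quadratic n₁ n₂).Monic := by
  unfold quadratic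
  monicity!

theorem natDegree_quadratic (n₁ n₂ : K[X]) : (quadratic n₁ n₂).natDegree = 2 := by
  unfold quadratic
  compute_degree!

theorem coeff_quadratic (n₁ n₂ : K[X]) (j : ℕ) : (quadratic n₁ n₂).coeff j =
    match j with | 0 => (n₁ - n₂) ^ 2 | 1 => -2 * (n₁ + n₂) | 2 => 1 | _ => 0 := by
  have h : quadratic n₁ n₂ = X ^ 2 + C (-2 * (n₁ + n₂)) * X ^ 1 + C ((n₁ - n₂) ^ 2) * X ^ 0 := by
    rw [quadratic, pow_one, pow_zero, mul_one]
  rw [h]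
  simp only [coeff_add, coeff_C_mul, coeff_X_pow]
  match j with
  | 0 => simp
  | 1 => simp
  | 2 => simp
  | n + 3 => simp

theorem eval₂_quadratic {S : Type*} [CommRing S] (φ : K[X] →+* S) {n₁ n₂ : K[X]} {a b : S}
    (ha : a ^ 2 = φ n₁) (hb : b ^ 2 = φ n₂) :
    eval₂ φ ((a + b) ^ 2) (quadratic n₁ n₂) = 0 := by
  simp only [quadratic, eval₂_add, eval₂_mul, eval₂_C, eval₂_X_pow, eval₂_X]
  simp only [map_neg, map_mul, map_add, map_pow, map_sub, map_ofNat, ← ha, ← hb]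
  ring

theorem irreducible_quadratic (h2 : (2 : K) ≠ 0) {n₁ n₂ : K[X]} (h₁₂ : ¬ IsSquare (n₁ * n₂)) :
    Irreducible (quadratic n₁ n₂) := by
  rw [(monic_quadratic _ _).irreducible_iff_natDegree']
  refine ⟨fun h1 => ?_, fun f g hf hg hfg hdeg => h₁₂ ?_⟩
  · have := natDegree_quadratic n₁ n₂
    rw [h1, natDegree_one] at this
    omega
  rw [natDegree_quadratic, Finset.mem_Ioc] at hdeg
  have hX : g = X + C (g.coeff 0) := hg.eq_X_add_C (by omega)
  have hroot : eval (-g.coeff 0) g = 0 := by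
    rw [hX]
    simp
  have hev := congrArg (eval (-g.coeff 0)) hfg
  rw [eval_mul, hroot, mul_zero] at hev
  simp only [quadratic, eval_add, eval_mul, eval_C, eval_X_pow, eval_X] at hev
  refine isSquare_of_four_mul h2 (b := -g.coeff 0 - (n₁ + n₂)) ?_
  linear_combination hev

/-- Sums of two modular square roots determine the quadratic whose roots they are. -/
theorem quadratic_eq_of_root (h2 : (2 : K) ≠ 0) (hφ : ∀ a, φ a = 0 → a ≠ 0 → r ≤ a.natDegree)
    (hr : 4 * m < r) {n₁ n₂ n₁' n₂' : K[X]} (h₁₂ : ¬ IsSquare (n₁ * n₂))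
    (h₁ : n₁.natDegree ≤ m) (h₂ : n₂.natDegree ≤ m) (h₁' : n₁'.natDegree ≤ m)
    (h₂' : n₂'.natDegree ≤ m) {z : L} (hz : eval₂ φ z (quadratic n₁ n₂) = 0)
    (hz' : eval₂ φ z (quadratic n₁' n₂') = 0) : quadratic n₁ n₂ = quadratic n₁' n₂' := by
  have hw : ∀ a b : K[X], a.natDegree ≤ m → b.natDegree ≤ m → wdeg m (quadratic a b) ≤ 2 * m := by
    intro a b ha hb
    refine wdeg_le_of_natDegree_coeff_le (μ := m) (fun j => ?_) (natDegree_quadratic a b).le le_rfl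
    rw [coeff_quadratic]
    match j with
    | 0 => exact (natDegree_pow_le_of_le 2 (natDegree_sub_le_of_le ha hb)).trans (by simp)
    | 1 =>
      refine (natDegree_mul_le_of_le (m := 0) ?_ (natDegree_add_le_of_degree_le ha hb)).trans
        (by omega)
      rw [natDegree_neg]
      exact (natDegree_ofNat 2).le
    | 2 => simp
    | n + 3 => simp
  by_contra hne
  have hdvd : ¬ quadratic n₁ n₂ ∣ quadratic n₁' n₂' := by
    intro h
    exact hne (eq_of_monic_of_dvd_of_natDegree_le (monic_quadratic _ _) (monic_quadratic _ _) h
      (by rw [natDegree_quadratic, natDegree_quadratic])).symm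
  -- With both weights at most `2m`, the resultant gives `r + 4m ≤ 8m`.
  have key := add_mul_le_of_isRelPrime (m := m) hφ (monic_quadratic _ _).ne_zero
    (monic_quadratic _ _).ne_zero (isRelPrime_of_irreducible (irreducible_quadratic h2 h₁₂) hdvd)
    (by rw [natDegree_quadratic]; omega) hz hz'
  rw [natDegree_quadratic, natDegree_quadratic] at key
  have e1 := hw n₁ n₂ h₁ h₂
  have e2 := hw n₁' n₂' h₁' h₂'
  omega

end Lines

/-! ### Dimensions of the spaces of short vanishing cubics -/

section Lattice

variable {K L : Type*} [Field K] [Field L]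

theorem smul_eq_C_C_mul (c : K) (f : K[X][X]) : c • f = C (C c) * f := by
  ext j t
  rw [coeff_smul, coeff_smul, coeff_C_mul, coeff_C_mul, smul_eq_mul]

/-- The polynomials of degree at most `3` over `K[T]` of weighted degree less than `s` which vanish
at `z`. -/
noncomputable def vanishingCubics (φ : K[X] →+* L) (z : L) (m s : ℕ) : Submodule K K[X][X] where
  carrier := {f | f.natDegree ≤ 3 ∧ (∀ j t, s ≤ t + j * m → (f.coeff j).coeff t = 0) ∧
    eval₂ φ z f = 0}
  add_mem' := by
    rintro f g ⟨hf1, hf2, hf3⟩ ⟨hg1, hg2, hg3⟩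
    refine ⟨natDegree_add_le_of_degree_le hf1 hg1, fun j t h => ?_, ?_⟩
    · rw [coeff_add, coeff_add, hf2 j t h, hg2 j t h, add_zero]
    · rw [eval₂_add, hf3, hg3, add_zero]
  zero_mem' := ⟨by simp, by simp, by simp⟩
  smul_mem' := by
    rintro c f ⟨hf1, hf2, hf3⟩
    refine ⟨(natDegree_smul_le _ _).trans hf1, fun j t h => ?_, ?_⟩
    · rw [coeff_smul, coeff_smul, hf2 j t h, smul_zero]
    · rw [smul_eq_C_C_mul, eval₂_mul, hf3, mul_zero]

/-- The polynomials proportional to `v` over the field of fractions of `K[T]`. -/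
noncomputable def proportional (v : K[X][X]) : Submodule K K[X][X] where
  carrier := {f | ∃ a b : K[X], a ≠ 0 ∧ C a * f = C b * v}
  add_mem' := by
    rintro f g ⟨a, b, ha, h⟩ ⟨a', b', ha', h'⟩
    refine ⟨a * a', b * a' + b' * a, mul_ne_zero ha ha', ?_⟩
    simp only [C_mul, C_add]
    linear_combination C a' * h + C a * h'
  zero_mem' := ⟨1, 0, one_ne_zero, by simp⟩
  smul_mem' := by
    rintro c f ⟨a, b, ha, h⟩
    refine ⟨a, C c * b, ha, ?_⟩
    rw [smul_eq_C_C_mul, C_mul]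
    linear_combination C (C c) * h

variable {φ : K[X] →+* L} {z : L} {m r s : ℕ}

theorem mem_vanishingCubics {f : K[X][X]} (hf : f ≠ 0) : f ∈ vanishingCubics φ z m s ↔
    f.natDegree ≤ 3 ∧ wdeg m f < s ∧ eval₂ φ z f = 0 := by
  rw [wdeg_lt_iff hf]
  rfl

theorem vanishingCubics_mono : Monotone (vanishingCubics φ z m) :=
  fun _ _ h _ hf => ⟨hf.1, fun j t ht => hf.2.1 j t (h.trans ht), hf.2.2⟩

instance : Module.Finite K (vanishingCubics φ z m s) := by
  let ι : vanishingCubics φ z m s →ₗ[K] (Fin 4 → Fin s → K) :=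
    { toFun := fun f j t => (f.1.coeff j).coeff t
      map_add' := fun f g => by ext; simp
      map_smul' := fun c f => by ext; simp }
  refine Module.Finite.of_injective ι ?_
  rw [injective_iff_map_eq_zero]
  rintro ⟨f, hf⟩ h0
  ext j t
  change (f.coeff j).coeff t = 0
  by_cases hj : j < 4
  · by_cases ht : t < s
    · exact congrFun (congrFun h0 ⟨j, hj⟩) ⟨t, ht⟩
    · exact hf.2.1 j t (by omega)
  · have h1 : f.coeff j = 0 := coeff_eq_zero_of_natDegree_lt (hf.1.trans_lt (by omega))
    rw [h1, coeff_zero]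

/-- The leading coefficients of weighted degree `s`. -/
noncomputable def leadingCoeffs (φ : K[X] →+* L) (z : L) (m s : ℕ) :
    vanishingCubics φ z m (s + 1) →ₗ[K] (Fin 4 → K) where
  toFun f j := if (j : ℕ) * m ≤ s then (f.1.coeff j).coeff (s - j * m) else 0
  map_add' f g := by
    ext j
    simp only [Submodule.coe_add, coeff_add, Pi.add_apply]
    split_ifs <;> simp
  map_smul' c f := by
    ext j
    simp only [Submodule.coe_smul, coeff_smul, Pi.smul_apply, RingHom.id_apply]
    split_ifs <;> simp

/-- Lifts of the four basis vectors would be independent over `K[T]`, and the determinant bound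
would give `r + 6m ≤ 4s < 16m`. -/
theorem leadingCoeffs_not_surjective (hφ : ∀ a, φ a = 0 → a ≠ 0 → r ≤ a.natDegree)
    (hr : 10 * m ≤ r) (hs : s < 4 * m) : ¬ Function.Surjective (leadingCoeffs φ z m s) := by
  intro hsurj
  choose h hh using fun i : Fin 4 => hsurj (Pi.single i 1)
  have hc : ∀ i j : Fin 4, (if (j : ℕ) * m ≤ s then ((h i).1.coeff j).coeff (s - j * m) else 0) =
      if i = j then (1 : K) else 0 := by
    intro i j
    have := congrFun (hh i) j
    rw [Pi.single_apply] at this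
    simp only [eq_comm (a := i)]
    exact this
  have hjs : ∀ j : Fin 4, (j : ℕ) * m ≤ s := by
    intro j
    by_contra hj
    have := hc j j
    simp [hj] at this
  have hc' : ∀ i j : Fin 4, ((h i).1.coeff j).coeff (s - j * m) = if i = j then (1 : K) else 0 := by
    intro i j
    rw [← hc i j, if_pos (hjs j)]
  have hne : ∀ i, (h i).1 ≠ 0 := by
    intro i h0
    have := hc' i i
    simp [h0] at this
  have hmem := fun i => (mem_vanishingCubics (hne i)).1 (h i).2
  have hdeg : ∀ i (j : Fin 4), ((h i).1.coeff j).natDegree ≤ s - j * m := by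
    intro i j
    by_cases h0 : (h i).1.coeff j = 0
    · simp [h0]
    · have h1 := natDegree_coeff_add_le_wdeg (m := m) _ h0
      have h2 := (hmem i).2.1
      omega
  have key := add_le_sum_wdeg (m := m) hφ (n := 4) (by norm_num) (fun i => (h i).1)
    (fun i => by have := (hmem i).1; omega) z (fun i => (hmem i).2.2) ?_
  · have h1 : ∑ i, wdeg m (h i).1 ≤ ∑ _i : Fin 4, s :=
      Finset.sum_le_sum fun i _ => by have := (hmem i).2.1; omega
    have h2 : ∑ j : Fin 4, (j : ℕ) = 6 := rfl
    rw [h2] at key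
    simp only [Finset.sum_const, Finset.card_univ, Fintype.card_fin, smul_eq_mul] at h1
    omega
  · intro c hc0
    classical
    by_contra hcne
    obtain ⟨i₁, hi₁⟩ : ∃ i, c i ≠ 0 := by
      by_contra h0
      push Not at h0
      exact hcne (funext h0)
    -- In a relation, choose a multiplier of largest degree: in its own column, only its leading
    -- coefficient reaches the top position.
    obtain ⟨i₀, hi₀, hmax⟩ := Finset.exists_max_image (Finset.univ.filter fun i => c i ≠ 0)
      (fun i => (c i).natDegree) ⟨i₁, by simpa using hi₁⟩
    have h1 := congrArg (fun P => (coeff P (i₀ : ℕ)).coeff ((c i₀).natDegree + (s - i₀ * m))) hc0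
    simp only [finsetSum_coeff, coeff_C_mul, coeff_zero] at h1
    have h2 : ∀ i, (c i * (h i).1.coeff i₀).coeff ((c i₀).natDegree + (s - i₀ * m)) =
        (c i).coeff (c i₀).natDegree * if i = i₀ then 1 else 0 := by
      intro i
      by_cases hi : c i = 0
      · simp [hi]
      · rw [coeff_mul_add_eq_of_natDegree_le (hmax i (by simpa using hi)) (hdeg i i₀), hc' i i₀]
    simp only [h2, mul_ite, mul_one, mul_zero, Finset.sum_ite_eq', Finset.mem_univ, if_true,
      coeff_natDegree, leadingCoeff_eq_zero] at h1
    exact (Finset.mem_filter.1 hi₀).2 h1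

/-- The kernel of `leadingCoeffs` lies in weight below `s`, and its range is a proper subspace of a
four-dimensional space. -/
theorem finrank_vanishingCubics_succ_le (hφ : ∀ a, φ a = 0 → a ≠ 0 → r ≤ a.natDegree)
    (hr : 10 * m ≤ r) (hs : s < 4 * m) :
    Module.finrank K (vanishingCubics φ z m (s + 1)) ≤
      Module.finrank K (vanishingCubics φ z m s) + 3 := by
  have hadd := LinearMap.finrank_range_add_finrank_ker (K := K)
    (V := vanishingCubics φ z m (s + 1)) (V₂ := Fin 4 → K) (leadingCoeffs φ z m s)
  rw [← hadd, add_comm]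
  refine add_le_add ?_ ?_
  · have hker : ∀ f : LinearMap.ker (leadingCoeffs φ z m s),
        f.1.1 ∈ vanishingCubics φ z m s := by
      rintro ⟨⟨f, hf⟩, h0⟩
      refine ⟨hf.1, fun j t ht => ?_, hf.2.2⟩
      rcases Nat.lt_or_ge s (t + j * m) with h1 | h1
      · exact hf.2.1 j t h1
      · by_cases hj : j < 4
        · have h2 := congrFun (LinearMap.mem_ker.1 h0) ⟨j, hj⟩
          change (if j * m ≤ s then (f.coeff j).coeff (s - j * m) else 0) = 0 at h2
          rw [if_pos (by omega)] at h2
          rwa [show t = s - j * m by omega]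
        · have h2 : f.coeff j = 0 := coeff_eq_zero_of_natDegree_lt (hf.1.trans_lt (by omega))
          change (f.coeff j).coeff t = 0
          rw [h2, coeff_zero]
    refine LinearMap.finrank_le_finrank_of_injective (f := LinearMap.codRestrict
      (vanishingCubics φ z m s) ((Submodule.subtype _).comp (Submodule.subtype _)) hker) ?_
    intro f g hfg
    have h1 := congrArg Subtype.val hfg
    exact Subtype.ext (Subtype.ext h1)
  · have hlt : LinearMap.range (leadingCoeffs φ z m s) < ⊤ := by
      rw [lt_top_iff_ne_top, Ne, LinearMap.range_eq_top]
      exact leadingCoeffs_not_surjective hφ hr hs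
    have := Submodule.finrank_lt hlt.ne
    rw [Module.finrank_fin_fun] at this
    omega

/-- Multiplying `v` by a power of `T` produces an element of the line of weight exactly `s`. -/
theorem finrank_inf_proportional_lt {v : K[X][X]} (hv : v ≠ 0) (hv3 : v.natDegree ≤ 3)
    (hvz : eval₂ φ z v = 0) (hs : wdeg m v ≤ s) :
    Module.finrank K (vanishingCubics φ z m s ⊓ proportional v : Submodule K K[X][X]) <
      Module.finrank K (vanishingCubics φ z m (s + 1) ⊓ proportional v : Submodule K K[X][X]) := by
  have : Module.Finite K (vanishingCubics φ z m (s + 1) ⊓ proportional v : Submodule K K[X][X]) :=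
    Submodule.finiteDimensional_of_le inf_le_left
  refine Submodule.finrank_lt_finrank_of_lt (lt_of_le_of_ne
    (inf_le_inf_right _ (vanishingCubics_mono (Nat.le_succ s))) fun heq => ?_)
  have hX : (C (X ^ (s - wdeg m v)) : K[X][X]) ≠ 0 := by simp
  have hne : C (X ^ (s - wdeg m v)) * v ≠ 0 := mul_ne_zero hX hv
  have hwX : wdeg m (C (X ^ (s - wdeg m v)) : K[X][X]) = s - wdeg m v := by
    refine le_antisymm (wdeg_le fun j hj => ?_) ?_
    · rw [coeff_C] at hj ⊢
      split_ifs at hj ⊢ with h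
      · simp [h]
      · exact absurd rfl hj
    · have := natDegree_coeff_add_le_wdeg (m := m) (C (X ^ (s - wdeg m v)) : K[X][X]) (j := 0)
        (by rw [coeff_C_zero]; exact pow_ne_zero _ X_ne_zero)
      rwa [coeff_C_zero, natDegree_X_pow, zero_mul, add_zero] at this
  have hw : wdeg m (C (X ^ (s - wdeg m v)) * v) = s := by
    rw [wdeg_mul hX hv, hwX]
    omega
  have hmem : C (X ^ (s - wdeg m v)) * v ∈
      (vanishingCubics φ z m (s + 1) ⊓ proportional v : Submodule K K[X][X]) := by
    refine ⟨(mem_vanishingCubics hne).2 ⟨?_, by omega, by rw [eval₂_mul, hvz, mul_zero]⟩,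
      1, X ^ (s - wdeg m v), one_ne_zero, by rw [C_1, one_mul]⟩
    rw [natDegree_mul hX hv, natDegree_C, zero_add]
    exact hv3
  rw [← heq] at hmem
  have := ((mem_vanishingCubics hne).1 hmem.1).2.1
  omega

/-- If the shortest elements are proportional to each other, then few elements are not. -/
theorem finrank_vanishingCubics_le (hφ : ∀ a, φ a = 0 → a ≠ 0 → r ≤ a.natDegree)
    (hr : 10 * m ≤ r) {s₀ : ℕ} {v : K[X][X]} (hv : v ≠ 0) (hv3 : v.natDegree ≤ 3)
    (hvz : eval₂ φ z v = 0)
    (hmin : ∀ f ∈ vanishingCubics φ z m (4 * m), f ≠ 0 → wdeg m v ≤ wdeg m f)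
    (h0 : vanishingCubics φ z m s₀ ≤ proportional v) (hs₀ : s₀ ≤ s) (hs : s ≤ 4 * m) :
    Module.finrank K (vanishingCubics φ z m s) ≤
      Module.finrank K (vanishingCubics φ z m s ⊓ proportional v : Submodule K K[X][X]) +
        2 * (s - s₀) := by
  induction s, hs₀ using Nat.le_induction with
  | base => rw [inf_eq_left.2 h0]; omega
  | succ s hle ih =>
    have ih := ih (by omega)
    by_cases hbot : vanishingCubics φ z m (s + 1) = ⊥
    · rw [hbot, finrank_bot]
      omega
    -- A nonzero element shows that `v` has weight at most `s`. Of at most three new dimensions, one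
    -- then lies on the line.
    · obtain ⟨f, hf, hf0⟩ := Submodule.exists_mem_ne_zero_of_ne_bot hbot
      have h1 := hmin f (vanishingCubics_mono hs hf) hf0
      have h2 := ((mem_vanishingCubics hf0).1 hf).2.1
      have h3 := finrank_inf_proportional_lt (φ := φ) (z := z) (m := m) (s := s) hv hv3 hvz (by omega)
      have h4 := finrank_vanishingCubics_succ_le (φ := φ) (z := z) (m := m) (s := s) hφ hr (by omega)
      omega

end Lattice

/-! ### Counting quartics with a common root -/

section Count

variable {K L : Type*} [Field K] [Field L] {φ : K[X] →+* L} {z : L} {m r : ℕ}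

theorem four_ne_zero_of_two {R : Type*} [CommRing R] [IsDomain R] (h : (2 : R) ≠ 0) :
    (4 : R) ≠ 0 := by
  rw [show (4 : R) = 2 ^ 2 by norm_num]
  exact pow_ne_zero 2 h

/-- The relation `(4c₂ - c₃²)² = 64c₀` between the coefficients of a `quartic`, restricted to a
line. It would be trivial in `t` only if the line moved `c₁` alone. -/
theorem exists_ne_zero_quartic_root {k : Type*} [Field k] (h2 : (2 : k) ≠ 0) {c₀ c₂ c₃ v₀ v₂ v₃ : k}
    (hv : ¬ (v₀ = 0 ∧ v₂ = 0 ∧ v₃ = 0)) : ∃ p : k[X], p ≠ 0 ∧ p.natDegree ≤ 4 ∧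
      ∀ t, (4 * (c₂ + t * v₂) - (c₃ + t * v₃) ^ 2) ^ 2 = 64 * (c₀ + t * v₀) → p.IsRoot t := by
  have h4 := four_ne_zero_of_two h2
  have h64 : (64 : k) ≠ 0 := by
    rw [show (64 : k) = 4 ^ 3 by norm_num]
    exact pow_ne_zero 3 h4
  set a₀ := 4 * c₂ - c₃ ^ 2
  set a₁ := 4 * v₂ - 2 * c₃ * v₃ with ha₁
  refine ⟨C (v₃ ^ 4) * X ^ 4 + C (-2 * a₁ * v₃ ^ 2) * X ^ 3 + C (a₁ ^ 2 - 2 * a₀ * v₃ ^ 2) * X ^ 2 +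
    C (2 * a₀ * a₁ - 64 * v₀) * X ^ 1 + C (a₀ ^ 2 - 64 * c₀) * X ^ 0, fun h0 => hv ?_, ?_, ?_⟩
  · have hc := fun j => congrArg (fun P => coeff P j) h0
    simp only [coeff_add, coeff_C_mul, coeff_X_pow, coeff_zero] at hc
    have c4 := hc 4
    have c2 := hc 2
    have c1 := hc 1
    simp at c4 c2 c1
    have hv3 : v₃ = 0 := c4
    rw [hv3] at c2 ha₁
    have ha0 : a₁ = 0 := by simpa using c2
    rw [ha0] at ha₁ c1
    refine ⟨?_, ?_, hv3⟩
    · have : 64 * v₀ = 0 := by linear_combination -c1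
      exact (mul_eq_zero.1 this).resolve_left h64
    · have : 4 * v₂ = 0 := by linear_combination -ha₁
      exact (mul_eq_zero.1 this).resolve_left h4
  · compute_degree
  · intro t ht
    simp only [IsRoot.def, eval_add, eval_mul, eval_C, eval_X_pow]
    linear_combination ht

/-- A finite set whose differences lie in `V` is covered by few cosets of `W`, when the codimension
of `V ⊓ W` in `V` is small. -/
theorem card_le_mul_pow_of_finrank_le {K E : Type*} [Field K] [Finite K] [AddCommGroup E]
    [Module K E] {V W : Submodule K E} [Module.Finite K V] {e : ℕ}
    (h : Module.finrank K V ≤ Module.finrank K (V ⊓ W : Submodule K E) + e) (P : Finset E)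
    (hP : ∀ x ∈ P, ∀ y ∈ P, x - y ∈ V) (n : ℕ)
    (hn : ∀ Q ⊆ P, (∀ x ∈ Q, ∀ y ∈ Q, x - y ∈ W) → Q.card ≤ n) :
    P.card ≤ n * Nat.card K ^ e := by
  classical
  rcases P.eq_empty_or_nonempty with rfl | ⟨x₀, hx₀⟩
  · simp
  let U : Submodule K V := W.comap V.subtype
  have hU : Module.finrank K U = Module.finrank K (V ⊓ W : Submodule K E) := by
    rw [← Submodule.map_comap_subtype, Submodule.finrank_map_subtype_eq]
  have hquot : Module.finrank K (V ⧸ U) ≤ e := by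
    have := Submodule.finrank_quotient_add_finrank U
    omega
  have hfin : Finite (V ⧸ U) := Module.finite_of_finite K
  let := Fintype.ofFinite (V ⧸ U)
  have hcard : Fintype.card (V ⧸ U) = Nat.card K ^ Module.finrank K (V ⧸ U) := by
    rw [← Nat.card_eq_fintype_card, Module.natCard_eq_pow_finrank (K := K)]
  let π : E → V ⧸ U := fun x => if h : x - x₀ ∈ V then U.mkQ ⟨x - x₀, h⟩ else 0
  have hπ : ∀ x ∈ P, ∀ y ∈ P, π x = π y → x - y ∈ W := by
    intro x hx y hy h
    simp only [π, dif_pos (hP x hx x₀ hx₀), dif_pos (hP y hy x₀ hx₀)] at h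
    have h1 : x - x₀ - (y - x₀) ∈ W := (Submodule.Quotient.eq U).1 h
    rwa [sub_sub_sub_cancel_right] at h1
  calc P.card ≤ n * (P.image π).card := by
        refine Finset.card_le_mul_card_image _ _ fun c _ => hn _ (Finset.filter_subset _ _) ?_
        intro x hx y hy
        rw [Finset.mem_filter] at hx hy
        exact hπ x hx.1 y hy.1 (hx.2.trans hy.2.symm)
    _ ≤ n * Fintype.card (V ⧸ U) := Nat.mul_le_mul_left _ (Finset.card_le_univ _)
    _ ≤ _ := by
        rw [hcard]
        exact Nat.mul_le_mul_left _ (Nat.pow_le_pow_right Nat.card_pos hquot)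

/-- A line contains at most four of the polynomials `quartic p u e`. -/
theorem card_le_four (h2 : (2 : K) ≠ 0) {v : K[X][X]}
    (hv : ¬ (v.coeff 0 = 0 ∧ v.coeff 2 = 0 ∧ v.coeff 3 = 0)) (P : Finset K[X][X])
    (hP : ∀ D ∈ P, ∃ p u e, D = quartic p u e)
    (hline : ∀ D ∈ P, ∀ D' ∈ P, D - D' ∈ proportional v) : P.card ≤ 4 := by
  classical
  rcases P.eq_empty_or_nonempty with rfl | ⟨D₀, hD₀⟩
  · simp
  -- Over the fraction field every member of `P` is `D₀ + t v`, and `t` determines it.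
  let k := FractionRing K[X]
  let ι : K[X] →+* k := algebraMap K[X] k
  have hι : Function.Injective ι := IsFractionRing.injective K[X] k
  have hτ : ∀ D : K[X][X], ∃ t : k, D ∈ P →
      ∀ j, ι (D.coeff j) = ι (D₀.coeff j) + t * ι (v.coeff j) := by
    intro D
    by_cases hD : D ∈ P
    · obtain ⟨a, b, ha, hab⟩ := hline D hD D₀ hD₀
      refine ⟨ι b / ι a, fun _ j => ?_⟩
      have ha' : ι a ≠ 0 := (map_ne_zero_iff ι hι).2 ha
      have h1 := congrArg (fun P => ι (coeff P j)) hab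
      simp only [coeff_C_mul, coeff_sub, map_mul, map_sub] at h1
      rw [div_mul_eq_mul_div, ← sub_eq_iff_eq_add', eq_div_iff ha']
      linear_combination h1
    · exact ⟨0, fun h => absurd h hD⟩
  choose t ht using hτ
  have h2k : (2 : k) ≠ 0 := by
    have h2' : (2 : K[X]) ≠ 0 := by
      intro h0
      exact h2 (by simpa using congrArg (fun P => coeff P 0) h0)
    rw [← map_ofNat ι 2]
    exact (map_ne_zero_iff ι hι).2 h2'
  obtain ⟨p, hp0, hp4, hp⟩ := exists_ne_zero_quartic_root h2k (c₀ := ι (D₀.coeff 0))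
    (c₂ := ι (D₀.coeff 2)) (c₃ := ι (D₀.coeff 3)) (v₀ := ι (v.coeff 0)) (v₂ := ι (v.coeff 2))
    (v₃ := ι (v.coeff 3)) (by simpa only [map_eq_zero_iff ι hι] using hv)
  have hroots : ∀ D ∈ P, t D ∈ p.roots.toFinset := by
    intro D hD
    rw [Multiset.mem_toFinset, mem_roots hp0]
    apply hp
    rw [← ht D hD, ← ht D hD, ← ht D hD]
    obtain ⟨q, u, e, rfl⟩ := hP D hD
    have e0 : (quartic q u e).coeff 0 = u ^ 2 := coeff_quartic_form _ _ _ _ _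
    have e2 : (quartic q u e).coeff 2 = 4 * q ^ 2 + 2 * u := coeff_quartic_form _ _ _ _ _
    have e3 : (quartic q u e).coeff 3 = -4 * q := coeff_quartic_form _ _ _ _ _
    rw [e0, e2, e3]
    simp only [map_mul, map_add, map_pow, map_neg, map_ofNat]
    ring
  have hinj : Set.InjOn t (P : Set K[X][X]) := by
    intro D hD D' hD' h
    ext1 j
    apply hι
    rw [ht D hD, ht D' hD', h]
  calc P.card ≤ p.roots.toFinset.card := Finset.card_le_card_of_injOn t hroots hinj
    _ ≤ p.roots.card := Multiset.toFinset_card_le _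
    _ ≤ p.natDegree := card_roots' p
    _ ≤ 4 := hp4

/-- A bound for the number of short quartics with a common root modulo `F`. -/
theorem card_quartics_le [Finite K] (h2 : (2 : K) ≠ 0)
    (hφ : ∀ a, φ a = 0 → a ≠ 0 → r ≤ a.natDegree) (hr : 12 * m ≤ r) (hz : z ≠ 0)
    (P : Finset K[X][X]) (hP : ∀ D ∈ P, ∃ p u e, D = quartic p u e)
    (hroot : ∀ D ∈ P, eval₂ φ z D = 0) (hirr : ∀ D ∈ P, Irreducible D)
    (hdeg : ∀ D ∈ P, ∀ j, (D.coeff j).natDegree ≤ (4 - j) * (m - 1)) (hm : 0 < m) :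
    P.card ≤ 4 * Nat.card K ^ (2 * (4 * m - (r + 9 * m + 5) / 6)) := by
  classical
  rcases P.eq_empty_or_nonempty with rfl | ⟨D₀, hD₀⟩
  · simp
  have hD4 : ∀ D ∈ P, D.natDegree = 4 := by
    intro D hD
    obtain ⟨p, u, e, rfl⟩ := hP D hD
    exact natDegree_quartic p u e
  have hsub : ∀ D ∈ P, ∀ D' ∈ P, D - D' ∈ vanishingCubics φ z m (4 * m) := by
    intro D hD D' hD'
    refine ⟨?_, fun j s hs => ?_, by rw [eval₂_sub, hroot D hD, hroot D' hD', sub_zero]⟩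
    · rw [natDegree_le_iff_coeff_eq_zero]
      intro j hj
      obtain ⟨p, u, e, rfl⟩ := hP D hD
      obtain ⟨p', u', e', rfl⟩ := hP D' hD'
      rw [coeff_sub, quartic, quartic, coeff_quartic_form, coeff_quartic_form]
      match j, hj with
      | 4, _ => simp
      | n + 5, _ => simp
    · rcases Nat.lt_or_ge 3 j with hj | hj
      · obtain ⟨p, u, e, rfl⟩ := hP D hD
        obtain ⟨p', u', e', rfl⟩ := hP D' hD'
        rw [coeff_sub, quartic, quartic, coeff_quartic_form, coeff_quartic_form]
        match j, hj with
        | 4, _ => simp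
        | n + 5, _ => simp
      · apply coeff_eq_zero_of_natDegree_lt
        rw [coeff_sub]
        refine (natDegree_sub_le_of_le (hdeg D hD j) (hdeg D' hD' j)).trans_lt ?_
        rw [max_self]
        -- The bound `m - 1` rather than `m` makes the weight of the difference strictly less than
        -- `4m`, as `j ≤ 3`.
        have h1 : (4 - j) * (m - 1) + (4 - j) = (4 - j) * m := by
          rw [← Nat.mul_succ, Nat.succ_eq_add_one, Nat.sub_add_cancel hm]
        have h3 : (4 - j) * m + j * m = 4 * m := by
          rw [← add_mul, Nat.sub_add_cancel (by omega)]
        omega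
  have hDm : wdeg m D₀ ≤ 4 * m :=
    wdeg_le_of_natDegree_coeff_le (hdeg D₀ hD₀) (hD4 D₀ hD₀).le (Nat.sub_le _ _)
  by_cases hbot : vanishingCubics φ z m (4 * m) = ⊥
  · have h1 : P.card ≤ 1 := by
      refine Finset.card_le_one.2 fun D hD D' hD' => ?_
      have := hsub D hD D' hD'
      rw [hbot, Submodule.mem_bot] at this
      exact sub_eq_zero.1 this
    have h3 : 0 < Nat.card K ^ (2 * (4 * m - (r + 9 * m + 5) / 6)) := pow_pos Nat.card_pos _
    omega
  obtain ⟨f, hf, hf0⟩ := Submodule.exists_mem_ne_zero_of_ne_bot hbot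
  obtain ⟨v, ⟨hvmem, hv0⟩, hvmin⟩ := exists_minimalFor_of_wellFoundedLT
    (fun f => f ∈ vanishingCubics φ z m (4 * m) ∧ f ≠ 0) (wdeg m) ⟨f, hf, hf0⟩
  have hmin : ∀ f ∈ vanishingCubics φ z m (4 * m), f ≠ 0 → wdeg m v ≤ wdeg m f := by
    intro f hf hf0
    by_contra hlt
    exact hlt (hvmin ⟨hf, hf0⟩ (by omega))
  obtain ⟨hv3, hvm, hvz⟩ := (mem_vanishingCubics hv0).1 hvmem
  -- Otherwise `v = cX`; since `z ≠ 0`, `φ c = 0`, so `c` has degree at least `r`, too large for a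
  -- short `v`.
  have hcoef : ¬ (v.coeff 0 = 0 ∧ v.coeff 2 = 0 ∧ v.coeff 3 = 0) := by
    rintro ⟨e0, e2, e3⟩
    have hvX : v = C (v.coeff 1) * X := by
      ext1 j
      rw [coeff_C_mul, coeff_X]
      match j with
      | 0 => simp [e0]
      | 1 => simp
      | 2 => simp [e2]
      | 3 => simp [e3]
      | n + 4 => rw [coeff_eq_zero_of_natDegree_lt (by omega)]; simp
    have h1 : v.coeff 1 ≠ 0 := by
      intro h1
      rw [h1, C_0, zero_mul] at hvX
      exact hv0 hvX
    rw [hvX, eval₂_mul, eval₂_C, eval₂_X] at hvz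
    have h3 := hφ _ ((mul_eq_zero.1 hvz).resolve_right hz) h1
    have h4 := natDegree_coeff_add_le_wdeg (m := m) v h1
    omega
  -- The quotient is `⌈(r + 9m)/6⌉`. Below it `6 wdeg w < r + 9m`, and `v` has minimal weight, so
  -- the hypothesis of `exists_smul_eq_smul` on the two weights holds.
  set s₀ := min (4 * m) ((r + 9 * m + 5) / 6) with hs₀
  have hs₀le : s₀ ≤ 4 * m := min_le_left _ _
  have hshort : vanishingCubics φ z m s₀ ≤ proportional v := by
    intro w hw
    by_cases hw0 : w = 0
    · rw [hw0]
      exact zero_mem _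
    obtain ⟨hw3, hwm, hwz⟩ := (mem_vanishingCubics hw0).1 hw
    have h1 := hmin w (vanishingCubics_mono hs₀le hw) hw0
    exact exists_smul_eq_smul hφ hr (hirr D₀ hD₀) (hD4 D₀ hD₀) hDm (hroot D₀ hD₀) hv0 hw0 hv3 hw3
      hvm (by omega) hvz hwz (by omega)
  have hrank := finrank_vanishingCubics_le hφ (by omega) hv0 hv3 hvz hmin hshort hs₀le le_rfl
  refine (card_le_mul_pow_of_finrank_le hrank P (fun D hD D' hD' => hsub D hD D' hD') 4
    fun Q hQ h => card_le_four h2 hcoef Q (fun D hD => hP D (hQ hD)) h).trans ?_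
  refine Nat.mul_le_mul_left _ (Nat.pow_le_pow_right Nat.card_pos ?_)
  omega

end Count

/-! ### Representations as sums of two or three square roots -/

section Fibres

variable {K L : Type*} [Field K] [Field L] {φ : K[X] →+* L} {m r : ℕ}

/-- `n` is a polynomial of degree less than `m` with modular square root `x`. -/
def IsShortSquare (φ : K[X] →+* L) (m : ℕ) (x : L) (n : K[X]) : Prop :=
  n.degree < m ∧ x ^ 2 = φ n

/-- `a` and `b` are square roots of short polynomials whose product is a square. -/
def IsSquarePair (φ : K[X] →+* L) (m : ℕ) (a b : L) : Prop :=
  ∃ n₁ n₂, IsShortSquare φ m a n₁ ∧ IsShortSquare φ m b n₂ ∧ IsSquare (n₁ * n₂)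

theorem natDegree_le_pred_of_degree_lt {n : K[X]} (h : n.degree < m) : n.natDegree ≤ m - 1 := by
  by_cases h0 : n = 0
  · simp [h0]
  · have := (natDegree_lt_iff_degree_lt h0).2 h
    omega

/-- The coefficients of `X³`, `X²` and `X` yield `p`, `u` and `e` in turn. -/
theorem quartic_injective (h2 : (2 : K) ≠ 0) {p u e p' u' e' : K[X]}
    (h : quartic p u e = quartic p' u' e') : p = p' ∧ u = u' ∧ e = e' := by
  have h2' : (2 : K[X]) ≠ 0 := by
    intro h0
    exact h2 (by simpa using congrArg (fun P => coeff P 0) h0)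
  have h4 := four_ne_zero_of_two h2'
  have h64 : (64 : K[X]) ≠ 0 := by
    rw [show (64 : K[X]) = 4 ^ 3 by norm_num]
    exact pow_ne_zero 3 h4
  have hc := fun j => congrArg (fun P => coeff P j) h
  simp only [quartic, coeff_quartic_form] at hc
  have c3 : -4 * p = -4 * p' := hc 3
  have c2 : 4 * p ^ 2 + 2 * u = 4 * p' ^ 2 + 2 * u' := hc 2
  have c1 : -(4 * p * u + 64 * e) = -(4 * p' * u' + 64 * e') := hc 1
  have hp : p = p' := mul_left_cancel₀ h4 (by linear_combination -c3)
  subst hp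
  have hu : u = u' := mul_left_cancel₀ h2' (by linear_combination c2)
  subst hu
  exact ⟨rfl, rfl, mul_left_cancel₀ h64 (by linear_combination -c1)⟩

theorem eq_or_eq_neg_of_root {a x y w : L}
    (h : (a ^ 2 - x ^ 2) * ((a ^ 2 - y ^ 2) * (a ^ 2 - w ^ 2)) = 0) :
    a = x ∨ a = -x ∨ a = y ∨ a = -y ∨ a = w ∨ a = -w := by
  rcases mul_eq_zero.1 h with h | h
  · rcases sq_eq_sq_iff_eq_or_eq_neg.1 (sub_eq_zero.1 h) with h | h <;> simp [h]
  rcases mul_eq_zero.1 h with h | h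
  · rcases sq_eq_sq_iff_eq_or_eq_neg.1 (sub_eq_zero.1 h) with h | h <;> simp [h]
  · rcases sq_eq_sq_iff_eq_or_eq_neg.1 (sub_eq_zero.1 h) with h | h <;> simp [h]

/-- An element is a sum of few triples of modular square roots, apart from degenerate triples. -/
theorem card_triples_le [Finite K] (h2 : (2 : K) ≠ 0)
    (hφ : ∀ a, φ a = 0 → a ≠ 0 → r ≤ a.natDegree) (hr : 12 * m ≤ r) (hm : 0 < m) (l : L)
    (S : Finset ((L × L) × L))
    (hS : ∀ t ∈ S, (∃ n, IsShortSquare φ m t.1.1 n) ∧ (∃ n, IsShortSquare φ m t.1.2 n) ∧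
      (∃ n, IsShortSquare φ m t.2 n) ∧ t.1.1 + t.1.2 + t.2 = l)
    (hS' : ∀ t ∈ S, ¬ IsSquarePair φ m t.1.1 t.1.2 ∧ ¬ IsSquarePair φ m t.1.1 t.2 ∧
      ¬ IsSquarePair φ m t.1.2 t.2) :
    S.card ≤ 144 * Nat.card K ^ (2 * (4 * m - (r + 9 * m + 5) / 6)) := by
  classical
  have hν : ∀ x : L, ∃ n, (∃ n', IsShortSquare φ m x n') → IsShortSquare φ m x n := by
    intro x
    by_cases h : ∃ n', IsShortSquare φ m x n'
    · exact ⟨h.choose, fun _ => h.choose_spec⟩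
    · exact ⟨0, fun h' => absurd h' h⟩
  choose ν hν using hν
  have hS₁ := fun t ht => hν _ (hS t ht).1
  have hS₂ := fun t ht => hν _ (hS t ht).2.1
  have hS₃ := fun t ht => hν _ (hS t ht).2.2.1
  have hsum := fun t ht => (hS t ht).2.2.2
  have hsq : ∀ t ∈ S, ¬ IsSquare (ν t.1.1 * ν t.1.2) ∧ ¬ IsSquare (ν t.1.1 * ν t.2) ∧
      ¬ IsSquare (ν t.1.2 * ν t.2) := fun t ht =>
    ⟨fun h => (hS' t ht).1 ⟨_, _, hS₁ t ht, hS₂ t ht, h⟩,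
      fun h => (hS' t ht).2.1 ⟨_, _, hS₁ t ht, hS₃ t ht, h⟩,
      fun h => (hS' t ht).2.2 ⟨_, _, hS₂ t ht, hS₃ t ht, h⟩⟩
  rcases S.eq_empty_or_nonempty with rfl | ⟨t₀, ht₀⟩
  · simp
  -- If `l = 0`, then `(n₃ - n₁ - n₂)² ≡ 4 n₁ n₂` modulo `F`. Both sides have degree below `r`, so
  -- this is an equality and `n₁ n₂` is a square.
  have hl : l ^ 2 ≠ 0 := by
    intro hl
    rw [sq_eq_zero_iff] at hl
    have h0 : φ ((ν t₀.2 - ν t₀.1.1 - ν t₀.1.2) ^ 2 - 4 * (ν t₀.1.1 * ν t₀.1.2)) = 0 := by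
      have h1 := hsum t₀ ht₀
      rw [hl] at h1
      simp only [map_sub, map_mul, map_pow, map_ofNat, ← (hS₁ t₀ ht₀).2, ← (hS₂ t₀ ht₀).2,
        ← (hS₃ t₀ ht₀).2]
      have h3 : t₀.2 = -(t₀.1.1 + t₀.1.2) := by linear_combination h1
      rw [h3]
      ring
    refine (hsq t₀ ht₀).1 (isSquare_of_four_mul h2 (b := ν t₀.2 - ν t₀.1.1 - ν t₀.1.2) ?_)
    by_contra hne
    have h1 := hφ _ h0 (fun h => hne (by linear_combination -h))
    have d1 := natDegree_le_pred_of_degree_lt (hS₁ t₀ ht₀).1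
    have d2 := natDegree_le_pred_of_degree_lt (hS₂ t₀ ht₀).1
    have d3 := natDegree_le_pred_of_degree_lt (hS₃ t₀ ht₀).1
    have d4 : ((ν t₀.2 - ν t₀.1.1 - ν t₀.1.2) ^ 2 - 4 * (ν t₀.1.1 * ν t₀.1.2)).natDegree ≤
        2 * (m - 1) := by
      refine (natDegree_sub_le_of_le (natDegree_pow_le_of_le 2 (natDegree_sub_le_of_le
        (natDegree_sub_le_of_le d3 d1) d2)) (natDegree_mul_le_of_le (m := 0)
        (natDegree_ofNat 4).le (natDegree_mul_le_of_le d1 d2))).trans ?_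
      rw [max_self, max_self]
      omega
    omega
  set g : (L × L) × L → K[X][X] := fun t => quartic (ν t.1.1 + ν t.1.2 + ν t.2)
    ((ν t.1.1 + ν t.1.2 + ν t.2) ^ 2 - 4 * (ν t.1.1 * ν t.1.2 + ν t.1.1 * ν t.2 + ν t.1.2 * ν t.2))
    (ν t.1.1 * ν t.1.2 * ν t.2) with hg
  have hP := card_quartics_le (φ := φ) (z := l ^ 2) h2 hφ hr hl (S.image g) ?_ ?_ ?_ ?_ hm
  -- The quartic determines the elementary symmetric functions of the three squares. So the first
  -- two entries have six possible values each, and the sum `l` fixes the third.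
  · have hfib : S.card ≤ 36 * (S.image g).card := by
      refine Finset.card_le_mul_card_image _ _ fun D hD => ?_
      obtain ⟨t₁, ht₁, rfl⟩ := Finset.mem_image.1 hD
      set A : Finset L := {t₁.1.1, -t₁.1.1, t₁.1.2, -t₁.1.2, t₁.2, -t₁.2} with hA
      have hA6 : A.card ≤ 6 := Finset.card_le_six
      have hmaps : ∀ t ∈ S.filter (fun t => g t = g t₁), t.1 ∈ A ×ˢ A := by
        intro t ht
        obtain ⟨htS, hgt⟩ := Finset.mem_filter.1 ht
        obtain ⟨e1, e2, e3⟩ := quartic_injective h2 hgt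
        have f1 := congrArg φ e1
        have f2 := congrArg φ e2
        have f3 := congrArg φ e3
        simp only [map_sub, map_add, map_mul, map_pow, map_ofNat, ← (hS₁ t htS).2,
          ← (hS₂ t htS).2, ← (hS₃ t htS).2, ← (hS₁ t₁ ht₁).2, ← (hS₂ t₁ ht₁).2,
          ← (hS₃ t₁ ht₁).2] at f1 f2 f3
        have h4 : (4 : L) ≠ 0 := by
          have := four_ne_zero_of_two h2
          rw [← map_ofNat (φ.comp C) 4]
          exact (map_ne_zero_iff _ (φ.comp C).injective).2 this
        rw [f1] at f2
        have f2' := mul_left_cancel₀ h4 (sub_right_injective f2)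
        rw [Finset.mem_product, hA]
        simp only [Finset.mem_insert, Finset.mem_singleton]
        constructor
        · apply eq_or_eq_neg_of_root
          linear_combination (t.1.1 ^ 4) * f1 - (t.1.1 ^ 2) * f2' + f3
        · apply eq_or_eq_neg_of_root
          linear_combination (t.1.2 ^ 4) * f1 - (t.1.2 ^ 2) * f2' + f3
      calc _ ≤ (A ×ˢ A).card := by
            refine Finset.card_le_card_of_injOn Prod.fst hmaps ?_
            intro t ht t' ht' h
            have s1 := hsum t (Finset.mem_filter.1 ht).1
            have s2 := hsum t' (Finset.mem_filter.1 ht').1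
            refine Prod.ext h ?_
            rw [h] at s1
            linear_combination s1 - s2
        _ ≤ 36 := by
            rw [Finset.card_product]
            nlinarith
    calc S.card ≤ 36 * (S.image g).card := hfib
      _ ≤ 36 * (4 * Nat.card K ^ (2 * (4 * m - (r + 9 * m + 5) / 6))) := Nat.mul_le_mul_left _ hP
      _ = _ := by ring
  · intro D hD
    obtain ⟨t, -, rfl⟩ := Finset.mem_image.1 hD
    exact ⟨_, _, _, rfl⟩
  · intro D hD
    obtain ⟨t, ht, rfl⟩ := Finset.mem_image.1 hD
    rw [← hsum t ht]
    exact eval₂_quartic φ (hS₁ t ht).2 (hS₂ t ht).2 (hS₃ t ht).2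
  · intro D hD
    obtain ⟨t, ht, rfl⟩ := Finset.mem_image.1 hD
    exact irreducible_quartic h2 (hsq t ht).1 (hsq t ht).2.1 (hsq t ht).2.2
  · intro D hD
    obtain ⟨t, ht, rfl⟩ := Finset.mem_image.1 hD
    have d1 := natDegree_le_pred_of_degree_lt (hS₁ t ht).1
    have d2 := natDegree_le_pred_of_degree_lt (hS₂ t ht).1
    have d3 := natDegree_le_pred_of_degree_lt (hS₃ t ht).1
    have dp : (ν t.1.1 + ν t.1.2 + ν t.2).natDegree ≤ m - 1 :=
      natDegree_add_le_of_degree_le (natDegree_add_le_of_degree_le d1 d2) d3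
    refine natDegree_coeff_quartic_le dp ?_ ?_
    · refine (natDegree_sub_le_of_le (natDegree_pow_le_of_le 2 dp) (natDegree_mul_le_of_le (m := 0)
        (natDegree_ofNat 4).le (natDegree_add_le_of_degree_le (natDegree_add_le_of_degree_le
        (natDegree_mul_le_of_le d1 d2) (natDegree_mul_le_of_le d1 d3))
        (natDegree_mul_le_of_le d2 d3)))).trans ?_
      exact max_le le_rfl (by omega)
    · exact (natDegree_mul_le_of_le (natDegree_mul_le_of_le d1 d2) d3).trans (by omega)

/-- An element is a sum of few pairs of modular square roots, apart from degenerate pairs. -/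
theorem card_pairs_le (h2 : (2 : K) ≠ 0) (hφ : ∀ a, φ a = 0 → a ≠ 0 → r ≤ a.natDegree)
    (hr : 4 * m < r) (l : L) (S : Finset (L × L))
    (hS : ∀ t ∈ S, (∃ n, IsShortSquare φ m t.1 n) ∧ (∃ n, IsShortSquare φ m t.2 n) ∧
      t.1 + t.2 = l) (hS' : ∀ t ∈ S, ¬ IsSquarePair φ m t.1 t.2) : S.card ≤ 4 := by
  classical
  rcases S.eq_empty_or_nonempty with rfl | ⟨t₀, ht₀⟩
  · simp
  obtain ⟨⟨n₁, h₁⟩, ⟨n₂, h₂⟩, hl⟩ := hS t₀ ht₀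
  have hsq : ¬ IsSquare (n₁ * n₂) := fun h => hS' t₀ ht₀ ⟨_, _, h₁, h₂, h⟩
  set A : Finset L := {t₀.1, -t₀.1, t₀.2, -t₀.2} with hA
  have hA4 : A.card ≤ 4 := Finset.card_le_four
  refine (Finset.card_le_card_of_injOn (t := A) Prod.fst ?_ ?_).trans hA4
  · intro t ht
    obtain ⟨⟨n₁', h₁'⟩, ⟨n₂', h₂'⟩, hl'⟩ := hS t ht
    have hd : ∀ {n : K[X]}, n.degree < m → n.natDegree ≤ m := fun h =>
      (natDegree_le_pred_of_degree_lt h).trans (Nat.sub_le _ _)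
    have hz := eval₂_quadratic φ h₁.2 h₂.2
    have hz' := eval₂_quadratic φ h₁'.2 h₂'.2
    rw [hl] at hz
    rw [hl'] at hz'
    have hq := quadratic_eq_of_root h2 hφ hr hsq (hd h₁.1) (hd h₂.1) (hd h₁'.1) (hd h₂'.1) hz hz'
    have c1 : -2 * (n₁ + n₂) = -2 * (n₁' + n₂') := by
      have := congrArg (fun P => coeff P 1) hq
      simpa only [coeff_quadratic] using this
    have c0 : (n₁ - n₂) ^ 2 = (n₁' - n₂') ^ 2 := by
      have := congrArg (fun P => coeff P 0) hq
      simpa only [coeff_quadratic] using this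
    have f1 := congrArg φ c1
    have f0 := congrArg φ c0
    simp only [map_sub, map_add, map_mul, map_pow, map_neg, map_ofNat, ← h₁.2, ← h₂.2, ← h₁'.2,
      ← h₂'.2] at f1 f0
    have h2L : (2 : L) ≠ 0 := by
      rw [← map_ofNat (φ.comp C) 2]
      exact (map_ne_zero_iff _ (φ.comp C).injective).2 h2
    have f1' : t₀.1 ^ 2 + t₀.2 ^ 2 = t.1 ^ 2 + t.2 ^ 2 :=
      mul_left_cancel₀ h2L (by linear_combination -f1)
    have f0' : t₀.1 ^ 2 * t₀.2 ^ 2 = t.1 ^ 2 * t.2 ^ 2 :=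
      mul_left_cancel₀ (four_ne_zero_of_two h2L) (by
        linear_combination (t₀.1 ^ 2 + t₀.2 ^ 2 + (t.1 ^ 2 + t.2 ^ 2)) * f1' - f0)
    -- Repeating `t₀.2` adapts the statement for three roots to two.
    have := eq_or_eq_neg_of_root (a := t.1) (x := t₀.1) (y := t₀.2) (w := t₀.2) (by
      linear_combination (t.1 ^ 2 - t₀.2 ^ 2) * (f0' - t.1 ^ 2 * f1'))
    rw [Finset.mem_coe, hA]
    simp only [Finset.mem_insert, Finset.mem_singleton]
    tauto
  · intro t ht t' ht' h
    have s1 := (hS t ht).2.2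
    have s2 := (hS t' ht').2.2
    refine Prod.ext h ?_
    rw [h] at s1
    linear_combination s1 - s2

end Fibres

/-! ### Additive energy of families -/

section Energy

variable {G ι κ : Type*} [DecidableEq G]

/-- The number of representations of `g` by the family `f` over `S`. -/
def reps (S : Finset ι) (f : ι → G) (g : G) : ℕ :=
  (S.filter fun i => f i = g).card

/-- The additive energy of the family `f` over `S`. -/
def energy [Fintype G] (S : Finset ι) (f : ι → G) : ℕ :=
  ∑ g, reps S f g ^ 2

theorem sum_reps [Fintype G] (S : Finset ι) (f : ι → G) : ∑ g, reps S f g = S.card :=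
  (Finset.card_eq_sum_card_fiberwise fun _ _ => Finset.mem_coe.2 (Finset.mem_univ _)).symm

theorem energy_le_of_reps_le [Fintype G] {S : Finset ι} {f : ι → G} {B : ℕ} (h : ∀ g, reps S f g ≤ B) :
    energy S f ≤ B * S.card := by
  rw [← sum_reps S f, Finset.mul_sum]
  refine Finset.sum_le_sum fun g _ => ?_
  rw [sq]
  exact Nat.mul_le_mul_right _ (h g)

theorem card_filter_product_eq_energy [Fintype G] (S : Finset ι) (f : ι → G) :
    ((S ×ˢ S).filter fun p => f p.1 = f p.2).card = energy S f := by
  rw [Finset.card_eq_sum_card_fiberwise (f := fun p => f p.1) (t := Finset.univ)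
    fun _ _ => Finset.mem_coe.2 (Finset.mem_univ _)]
  refine Finset.sum_congr rfl fun g _ => ?_
  rw [reps, sq, ← Finset.card_product]
  congr 1
  ext p
  simp only [Finset.mem_filter, Finset.mem_product]
  constructor
  · rintro ⟨⟨⟨h1, h2⟩, h3⟩, h4⟩
    exact ⟨⟨h1, h4⟩, h2, h3 ▸ h4⟩
  · rintro ⟨⟨h1, h4⟩, h2, h3⟩
    exact ⟨⟨⟨h1, h2⟩, h4.trans h3.symm⟩, h4⟩

theorem reps_product_add [AddCommGroup G] (S : Finset ι) (f : ι → G) (X : Finset G) (g : G) :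
    reps (S ×ˢ X) (fun p => f p.1 + p.2) g = ∑ x ∈ X, reps S f (g - x) := by
  classical
  rw [reps, Finset.card_eq_sum_card_fiberwise (f := Prod.snd) (t := X)]
  · refine Finset.sum_congr rfl fun x hx => ?_
    refine Finset.card_bij (fun p _ => p.1) ?_ ?_ ?_
    · intro p hp
      simp only [Finset.mem_filter, Finset.mem_product] at hp ⊢
      obtain ⟨⟨⟨h1, -⟩, h3⟩, rfl⟩ := hp
      exact ⟨h1, by rw [← h3]; abel⟩
    · intro p hp p' hp' h
      rw [Finset.mem_filter] at hp hp'
      exact Prod.ext h (hp.2.trans hp'.2.symm)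
    · intro i hi
      rw [Finset.mem_filter] at hi
      refine ⟨(i, x), ?_, rfl⟩
      simp only [Finset.mem_filter, Finset.mem_product]
      exact ⟨⟨⟨hi.1, hx⟩, by rw [hi.2]; abel⟩, trivial⟩
  · intro p hp
    exact (Finset.mem_product.1 (Finset.mem_filter.1 (Finset.mem_coe.1 hp)).1).2

/-- Cauchy–Schwarz over the new summand, followed by translation invariance of the energy. -/
theorem energy_product_add_le [AddCommGroup G] [Fintype G] (S : Finset ι) (f : ι → G) (X : Finset G) :
    energy (S ×ˢ X) (fun p => f p.1 + p.2) ≤ X.card ^ 2 * energy S f := by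
  calc energy (S ×ˢ X) (fun p => f p.1 + p.2)
      = ∑ g, (∑ x ∈ X, reps S f (g - x)) ^ 2 := by
        refine Finset.sum_congr rfl fun g _ => ?_
        rw [reps_product_add]
    _ ≤ ∑ g, X.card * ∑ x ∈ X, reps S f (g - x) ^ 2 :=
        Finset.sum_le_sum fun g _ => sq_sum_le_card_mul_sum_sq
    _ = X.card * ∑ x ∈ X, ∑ g, reps S f (g - x) ^ 2 := by
        rw [← Finset.mul_sum, Finset.sum_comm]
    _ = X.card * ∑ _x ∈ X, energy S f := by
        congr 1
        refine Finset.sum_congr rfl fun x _ => ?_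
        exact Equiv.sum_comp (Equiv.subRight x) (fun g => reps S f g ^ 2)
    _ = X.card ^ 2 * energy S f := by
        rw [Finset.sum_const, smul_eq_mul]
        ring

theorem reps_le_add_of_subset_union [DecidableEq ι] {S A B : Finset ι} (h : S ⊆ A ∪ B)
    (f : ι → G) (g : G) : reps S f g ≤ reps A f g + reps B f g := by
  rw [reps, reps, reps]
  refine (Finset.card_le_card (Finset.filter_subset_filter _ h)).trans ?_
  rw [Finset.filter_union]
  exact Finset.card_union_le _ _

theorem energy_union_le [Fintype G] [DecidableEq ι] {S A B : Finset ι} (h : S ⊆ A ∪ B) (f : ι → G) :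
    energy S f ≤ 2 * energy A f + 2 * energy B f := by
  rw [energy, energy, energy, Finset.mul_sum, Finset.mul_sum, ← Finset.sum_add_distrib]
  refine Finset.sum_le_sum fun g _ => ?_
  have h1 := reps_le_add_of_subset_union h f g
  have h2 : reps S f g ^ 2 ≤ (reps A f g + reps B f g) ^ 2 := Nat.pow_le_pow_left h1 2
  have h3 := two_mul_le_add_sq (reps A f g) (reps B f g)
  nlinarith

/-- A bound for the energy of a family whose members are determined by their value and a parameter
in `Q`. -/
theorem energy_le_of_determined [Fintype G] {S : Finset ι} {f : ι → G} (Q : Finset κ)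
    (π : ι → κ) (hπ : ∀ i ∈ S, π i ∈ Q) (hinj : ∀ i ∈ S, ∀ j ∈ S, π i = π j → f i = f j → i = j) :
    energy S f ≤ Q.card * S.card := by
  refine energy_le_of_reps_le fun g => ?_
  refine Finset.card_le_card_of_injOn π (fun i hi => hπ i (Finset.mem_filter.1 hi).1) ?_
  intro i hi j hj h
  have hi' := Finset.mem_filter.1 (Finset.mem_coe.1 hi)
  have hj' := Finset.mem_filter.1 (Finset.mem_coe.1 hj)
  exact hinj i hi'.1 j hj'.1 h (hi'.2.trans hj'.2.symm)

end Energy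

/-! ### Counting square roots and pairs whose product is a square -/

section Counting

variable {K L : Type*} [Field K] [Field L] {φ : K[X] →+* L} {m r : ℕ}

theorem card_shortPolys (K : Type*) [Field K] [Finite K] (m : ℕ) :
    (finite_shortPolys K m).toFinset.card = Nat.card K ^ m := by
  have h : Nat.card (degreeLT K m) = Nat.card K ^ m := by
    rw [Nat.card_congr (degreeLTEquiv K m).toEquiv, Nat.card_fun, Nat.card_fin]
  rw [← h, ← Set.ncard_eq_toFinset_card _ (finite_shortPolys K m), ← Nat.card_coe_set_eq]
  refine Nat.card_congr (Equiv.subtypeEquivRight fun x => ?_)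
  exact mem_degreeLT.symm

/-- After removal of the greatest common divisor, coprime factors of a square are squares up to
units. The constant `w` absorbs the units and may vanish. -/
theorem exists_of_isSquare_mul (hm : 0 < m) {a b : K[X]} (ha : a.degree < m) (hb : b.degree < m)
    (h : IsSquare (a * b)) : ∃ k < m, ∃ c ∈ shortPolys K (k + 1), ∃ w : K,
      ∃ s ∈ shortPolys K ((m - 1 - k) / 2 + 1), ∃ t ∈ shortPolys K ((m - 1 - k) / 2 + 1),
        a = c * s ^ 2 ∧ b = C w * c * t ^ 2 := by
  have hdeg : ∀ {n : K[X]} {k : ℕ}, n.natDegree ≤ k → n ∈ shortPolys K (k + 1) := fun h =>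
    (degree_le_natDegree.trans_lt (by exact_mod_cast Nat.lt_succ_of_le h))
  have hda := natDegree_le_pred_of_degree_lt ha
  have hdb := natDegree_le_pred_of_degree_lt hb
  by_cases ha0 : a = 0
  · subst ha0
    exact ⟨b.natDegree, by omega, b, hdeg le_rfl, 1, 0, hdeg (by simp), 1, hdeg (by simp),
      by simp, by simp⟩
  by_cases hb0 : b = 0
  · subst hb0
    exact ⟨a.natDegree, by omega, a, hdeg le_rfl, 0, 1, hdeg (by simp), 0, hdeg (by simp),
      by simp, by simp⟩
  obtain ⟨a', b', c, hrel, rfl, rfl⟩ := UniqueFactorizationMonoid.exists_reduced_factors a ha0 b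
  have hc : c ≠ 0 := left_ne_zero_of_mul ha0
  have ha' : a' ≠ 0 := right_ne_zero_of_mul ha0
  have hb' : b' ≠ 0 := right_ne_zero_of_mul hb0
  have hsq : IsSquare (a' * b') := by
    obtain ⟨d, hd⟩ := h
    refine isSquare_of_mul_sq hc (h := d) ?_
    rw [sq d, ← hd]
    ring
  obtain ⟨d, hd⟩ := hsq
  have hcop : IsCoprime a' b' := hrel.isCoprime
  obtain ⟨s, u, hs⟩ := exists_associated_pow_of_mul_eq_pow' hcop (hd.trans (sq d).symm)
  obtain ⟨t, v, ht⟩ := exists_associated_pow_of_mul_eq_pow' hcop.symm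
    ((mul_comm _ _).trans (hd.trans (sq d).symm))
  obtain ⟨u₀, hu₀, hu⟩ := Polynomial.isUnit_iff.1 u.isUnit
  obtain ⟨v₀, hv₀, hv⟩ := Polynomial.isUnit_iff.1 v.isUnit
  rw [← hu] at hs
  rw [← hv] at ht
  have hu0 : (C u₀ : K[X]) ≠ 0 := C_ne_zero.2 hu₀.ne_zero
  have hv0 : (C v₀ : K[X]) ≠ 0 := C_ne_zero.2 hv₀.ne_zero
  have hs0 : s ≠ 0 := by
    rintro rfl
    exact ha' (by rw [← hs]; simp)
  have ht0 : t ≠ 0 := by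
    rintro rfl
    exact hb' (by rw [← ht]; simp)
  have hds : a'.natDegree = 2 * s.natDegree := by
    rw [← hs, natDegree_mul (pow_ne_zero 2 hs0) hu0, natDegree_pow, natDegree_C, add_zero]
  have hdt : b'.natDegree = 2 * t.natDegree := by
    rw [← ht, natDegree_mul (pow_ne_zero 2 ht0) hv0, natDegree_pow, natDegree_C, add_zero]
  rw [natDegree_mul hc ha'] at hda
  rw [natDegree_mul hc hb'] at hdb
  refine ⟨c.natDegree, by omega, C u₀ * c, hdeg ?_, u₀⁻¹ * v₀, s, hdeg (by omega), t,
    hdeg (by omega), ?_, ?_⟩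
  · rw [natDegree_mul hu0 hc, natDegree_C, zero_add]
  · rw [← hs]
    ring
  · have h1 : (C (u₀⁻¹) : K[X]) * C u₀ = 1 := by
      rw [← C_mul, inv_mul_cancel₀ hu₀.ne_zero, C_1]
    rw [← ht, C_mul]
    linear_combination (-(c * t ^ 2 * C v₀)) * h1

theorem card_le_of_isSquare_mul [Finite K] (hm : 0 < m) (S : Finset (K[X] × K[X]))
    (hS : ∀ p ∈ S, p.1.degree < m ∧ p.2.degree < m ∧ IsSquare (p.1 * p.2)) :
    S.card ≤ m * Nat.card K ^ (m + 3) := by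
  classical
  have := Fintype.ofFinite K
  let A : ℕ → Finset K[X] := fun k => (finite_shortPolys K k).toFinset
  let T : ℕ → Finset (K[X] × K[X]) := fun k =>
    (A (k + 1) ×ˢ (Finset.univ : Finset K) ×ˢ A ((m - 1 - k) / 2 + 1) ×ˢ
      A ((m - 1 - k) / 2 + 1)).image fun x =>
        (x.1 * x.2.2.1 ^ 2, C x.2.1 * x.1 * x.2.2.2 ^ 2)
  have hT : ∀ k < m, (T k).card ≤ Nat.card K ^ (m + 3) := by
    intro k hk
    refine Finset.card_image_le.trans ?_
    simp only [Finset.card_product, A, card_shortPolys, Finset.card_univ,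
      ← Nat.card_eq_fintype_card]
    -- The choices are those of `c`, `w`, `s` and `t`. A long `c` leaves only short `s` and `t`, so
    -- the total does not depend on `k`.
    calc _ = Nat.card K ^ (k + 1 + 1 + ((m - 1 - k) / 2 + 1) + ((m - 1 - k) / 2 + 1)) := by ring
      _ ≤ _ := Nat.pow_le_pow_right Nat.card_pos (by omega)
  have hsub : S ⊆ (Finset.range m).biUnion T := by
    rintro ⟨a, b⟩ hp
    obtain ⟨h1, h2, h3⟩ := hS _ hp
    obtain ⟨k, hk, c, hc, w, s, hs, t, ht, hab⟩ := exists_of_isSquare_mul hm h1 h2 h3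
    refine Finset.mem_biUnion.2 ⟨k, Finset.mem_range.2 hk, Finset.mem_image.2
      ⟨(c, w, s, t), ?_, ?_⟩⟩
    · simp only [Finset.mem_product, A, Set.Finite.mem_toFinset, Finset.mem_univ, true_and]
      exact ⟨hc, hs, ht⟩
    · exact Prod.ext hab.1.symm hab.2.symm
  calc S.card ≤ ((Finset.range m).biUnion T).card := Finset.card_le_card hsub
    _ ≤ ∑ k ∈ Finset.range m, (T k).card := Finset.card_biUnion_le
    _ ≤ ∑ _k ∈ Finset.range m, Nat.card K ^ (m + 3) :=
        Finset.sum_le_sum fun k hk => hT k (Finset.mem_range.1 hk)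
    _ = _ := by rw [Finset.sum_const, Finset.card_range, smul_eq_mul]

theorem card_shortRoots_le [Finite K] (X : Finset L)
    (hX : ∀ x ∈ X, ∃ n, IsShortSquare φ m x n) : X.card ≤ 2 * Nat.card K ^ m := by
  classical
  have hν : ∀ x : L, ∃ n, x ∈ X → IsShortSquare φ m x n := by
    intro x
    by_cases h : x ∈ X
    · exact ⟨(hX x h).choose, fun _ => (hX x h).choose_spec⟩
    · exact ⟨0, fun h' => absurd h' h⟩
  choose ν hν using hν
  calc X.card ≤ 2 * (X.image ν).card := by
        refine Finset.card_le_mul_card_image _ _ fun n hn => ?_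
        obtain ⟨x₀, hx₀, rfl⟩ := Finset.mem_image.1 hn
        refine (Finset.card_le_card (t := {x₀, -x₀}) fun x hx => ?_).trans Finset.card_le_two
        obtain ⟨hx, hxn⟩ := Finset.mem_filter.1 hx
        have h1 : x ^ 2 = x₀ ^ 2 := by rw [(hν x hx).2, (hν x₀ hx₀).2, hxn]
        simpa using sq_eq_sq_iff_eq_or_eq_neg.1 h1
    _ ≤ 2 * (finite_shortPolys K m).toFinset.card := by
        refine Nat.mul_le_mul_left _ (Finset.card_le_card fun n hn => ?_)
        obtain ⟨x, hx, rfl⟩ := Finset.mem_image.1 hn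
        exact (Set.Finite.mem_toFinset _).2 (hν x hx).1
    _ = _ := by rw [card_shortPolys]

theorem card_squarePairs_le [Finite K] (hm : 0 < m) (Q : Finset (L × L))
    (hQ : ∀ p ∈ Q, IsSquarePair φ m p.1 p.2) : Q.card ≤ 4 * (m * Nat.card K ^ (m + 3)) := by
  classical
  have hν : ∀ p : L × L, ∃ n : K[X] × K[X], p ∈ Q →
      IsShortSquare φ m p.1 n.1 ∧ IsShortSquare φ m p.2 n.2 ∧ IsSquare (n.1 * n.2) := by
    intro p
    by_cases h : p ∈ Q
    · obtain ⟨n₁, n₂, h'⟩ := hQ p h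
      exact ⟨(n₁, n₂), fun _ => h'⟩
    · exact ⟨0, fun h' => absurd h' h⟩
  choose ν hν using hν
  calc Q.card ≤ 4 * (Q.image ν).card := by
        refine Finset.card_le_mul_card_image _ _ fun n hn => ?_
        obtain ⟨p, hp, rfl⟩ := Finset.mem_image.1 hn
        refine (Finset.card_le_card (t := {p.1, -p.1} ×ˢ {p.2, -p.2}) fun x hx => ?_).trans ?_
        · obtain ⟨hx, hxn⟩ := Finset.mem_filter.1 hx
          have h1 : x.1 ^ 2 = p.1 ^ 2 := by rw [(hν x hx).1.2, (hν p hp).1.2, hxn]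
          have h2 : x.2 ^ 2 = p.2 ^ 2 := by rw [(hν x hx).2.1.2, (hν p hp).2.1.2, hxn]
          rw [Finset.mem_product]
          exact ⟨by simpa using sq_eq_sq_iff_eq_or_eq_neg.1 h1,
            by simpa using sq_eq_sq_iff_eq_or_eq_neg.1 h2⟩
        · rw [Finset.card_product]
          exact Nat.mul_le_mul Finset.card_le_two Finset.card_le_two
    _ ≤ _ := by
        refine Nat.mul_le_mul_left _ (card_le_of_isSquare_mul hm _ fun n hn => ?_)
        obtain ⟨p, hp, rfl⟩ := Finset.mem_image.1 hn
        exact ⟨(hν p hp).1.1, (hν p hp).2.1.1, (hν p hp).2.2⟩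

end Counting

/-! ### Energy bounds for sums of two, three and four square roots -/

section Bounds

open scoped Classical in
/-- The square roots in `L` of the polynomials of degree less than `m`. -/
noncomputable def shortRoots {K L : Type*} [Field K] [Field L] [Fintype L] (φ : K[X] →+* L)
    (m : ℕ) : Finset L :=
  Finset.univ.filter fun x => ∃ n, IsShortSquare φ m x n

open scoped Classical in
/-- The pairs of square roots of polynomials whose product is a square. -/
noncomputable def squarePairs {K L : Type*} [Field K] [Field L] [Fintype L] (φ : K[X] →+* L)
    (m : ℕ) : Finset (L × L) :=
  (shortRoots φ m ×ˢ shortRoots φ m).filter fun p => IsSquarePair φ m p.1 p.2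

variable {K L : Type*} [Field K] [Field L] [Fintype L] {φ : K[X] →+* L} {m r : ℕ}

theorem mem_shortRoots {x : L} : x ∈ shortRoots φ m ↔ ∃ n, IsShortSquare φ m x n := by
  simp [shortRoots]

theorem mem_squarePairs {a b : L} (ha : a ∈ shortRoots φ m) (hb : b ∈ shortRoots φ m)
    (h : IsSquarePair φ m a b) : (a, b) ∈ squarePairs φ m := by
  classical
  exact Finset.mem_filter.2 ⟨Finset.mem_product.2 ⟨ha, hb⟩, h⟩

theorem card_squarePairs_sq_le [Finite K] (hm : 0 < m) : (squarePairs φ m).card ^ 2 ≤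
    16 * ((m + 1) ^ 2 * Nat.card K ^ 6) * Nat.card K ^ (2 * m) := by
  classical
  have hQ : (squarePairs φ m).card ≤ 4 * (m * Nat.card K ^ (m + 3)) :=
    card_squarePairs_le (φ := φ) hm _ fun p hp => (Finset.mem_filter.1 hp).2
  calc _ ≤ (4 * ((m + 1) * Nat.card K ^ (m + 3))) ^ 2 :=
        Nat.pow_le_pow_left (hQ.trans (Nat.mul_le_mul_left _ (Nat.mul_le_mul_right _ (by omega)))) 2
    _ = _ := by ring

variable [DecidableEq L]

theorem energy_pairs_le_card_pow (X : Finset L) :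
    energy (X ×ˢ X) (fun p => p.1 + p.2) ≤ X.card ^ 3 := by
  have h1 : energy X id ≤ 1 * X.card := by
    refine energy_le_of_reps_le fun g => Finset.card_le_one.2 fun x hx y hy => ?_
    exact (Finset.mem_filter.1 hx).2.trans (Finset.mem_filter.1 hy).2.symm
  calc _ ≤ X.card ^ 2 * energy X id := energy_product_add_le X id X
    _ ≤ X.card ^ 2 * (1 * X.card) := Nat.mul_le_mul_left _ h1
    _ = _ := by ring

/-- Nondegenerate pairs represent each element at most four times; for the square pairs the square
of their number suffices. -/
theorem energy_pairs_le (h2 : (2 : K) ≠ 0) (hφ : ∀ a, φ a = 0 → a ≠ 0 → r ≤ a.natDegree)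
    (hr : 4 * m < r) :
    energy (shortRoots φ m ×ˢ shortRoots φ m) (fun p => p.1 + p.2) ≤
      8 * (shortRoots φ m).card ^ 2 + 2 * (squarePairs φ m).card ^ 2 := by
  classical
  set X := shortRoots φ m with hX
  set A := (X ×ˢ X).filter fun p => ¬ IsSquarePair φ m p.1 p.2 with hA
  have hsub : X ×ˢ X ⊆ A ∪ squarePairs φ m := by
    intro p hp
    rw [Finset.mem_union]
    by_cases h : IsSquarePair φ m p.1 p.2
    · exact Or.inr (mem_squarePairs (Finset.mem_product.1 hp).1 (Finset.mem_product.1 hp).2 h)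
    · exact Or.inl (Finset.mem_filter.2 ⟨hp, h⟩)
  have h1 : energy A (fun p => p.1 + p.2) ≤ 4 * A.card := by
    refine energy_le_of_reps_le fun g => card_pairs_le h2 hφ hr g _ ?_ ?_
    · intro t ht
      obtain ⟨ht, hg⟩ := Finset.mem_filter.1 ht
      have := Finset.mem_product.1 (Finset.mem_filter.1 ht).1
      exact ⟨mem_shortRoots.1 this.1, mem_shortRoots.1 this.2, hg⟩
    · intro t ht
      exact (Finset.mem_filter.1 (Finset.mem_filter.1 ht).1).2
  have h3 : A.card ≤ X.card ^ 2 := by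
    rw [sq, ← Finset.card_product]
    exact Finset.card_filter_le _ _
  have h4 : energy (squarePairs φ m) (fun p => p.1 + p.2) ≤
      (squarePairs φ m).card * (squarePairs φ m).card :=
    energy_le_of_determined _ id (fun _ h => h) fun _ _ _ _ h _ => h
  have h5 := energy_union_le hsub (fun p => p.1 + p.2)
  nlinarith

theorem energy_triples_le [Finite K] (h2 : (2 : K) ≠ 0)
    (hφ : ∀ a, φ a = 0 → a ≠ 0 → r ≤ a.natDegree) (hr : 12 * m ≤ r) (hm : 0 < m) :
    energy ((shortRoots φ m ×ˢ shortRoots φ m) ×ˢ shortRoots φ m) (fun p => p.1.1 + p.1.2 + p.2) ≤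
      288 * Nat.card K ^ (2 * (4 * m - (r + 9 * m + 5) / 6)) * (shortRoots φ m).card ^ 3 +
        20 * ((squarePairs φ m).card ^ 2 * (shortRoots φ m).card) := by
  classical
  set X := shortRoots φ m with hX
  set Q := squarePairs φ m with hQ
  set S := (X ×ˢ X) ×ˢ X with hS
  have hmem : ∀ {t}, t ∈ S → t.1.1 ∈ X ∧ t.1.2 ∈ X ∧ t.2 ∈ X := by
    intro t ht
    rw [hS, Finset.mem_product, Finset.mem_product] at ht
    exact ⟨ht.1.1, ht.1.2, ht.2⟩
  set A := S.filter fun t => ¬ IsSquarePair φ m t.1.1 t.1.2 ∧ ¬ IsSquarePair φ m t.1.1 t.2 ∧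
    ¬ IsSquarePair φ m t.1.2 t.2 with hA
  set B₁ := S.filter fun t => IsSquarePair φ m t.1.1 t.1.2 with hB₁
  set B₂ := S.filter fun t => IsSquarePair φ m t.1.1 t.2 with hB₂
  set B₃ := S.filter fun t => IsSquarePair φ m t.1.2 t.2 with hB₃
  have hsub : S ⊆ A ∪ (B₁ ∪ (B₂ ∪ B₃)) := by
    intro t ht
    simp only [Finset.mem_union, hA, hB₁, hB₂, hB₃, Finset.mem_filter, ht, true_and]
    tauto
  have hcardB : ∀ (B : Finset ((L × L) × L)) (π : (L × L) × L → L × L) (σ : (L × L) × L → L),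
      (∀ t ∈ B, π t ∈ Q ∧ σ t ∈ X) → (∀ t ∈ B, ∀ t' ∈ B, π t = π t' → σ t = σ t' → t = t') →
      B.card ≤ Q.card * X.card := by
    intro B π σ h h'
    rw [← Finset.card_product]
    refine Finset.card_le_card_of_injOn (fun t => (π t, σ t))
      (fun t ht => Finset.mem_coe.2 (Finset.mem_product.2 (h t ht))) ?_
    intro t ht t' ht' htt
    exact h' t ht t' ht' (Prod.ext_iff.1 htt).1 (Prod.ext_iff.1 htt).2
  -- The degenerate pair `π t` and the sum determine the triple, so each sum has at most `|Q|`
  -- representations.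
  have hB : ∀ (B : Finset ((L × L) × L)) (π : (L × L) × L → L × L) (σ : (L × L) × L → L),
      (∀ t ∈ B, π t ∈ Q ∧ σ t ∈ X) → (∀ t ∈ B, ∀ t' ∈ B, π t = π t' → σ t = σ t' → t = t') →
      (∀ t ∈ B, ∀ t' ∈ B, π t = π t' → t.1.1 + t.1.2 + t.2 = t'.1.1 + t'.1.2 + t'.2 → t = t') →
      energy B (fun p => p.1.1 + p.1.2 + p.2) ≤ Q.card ^ 2 * X.card := by
    intro B π σ h h' h''
    refine (energy_le_of_determined Q π (fun t ht => (h t ht).1) h'').trans ?_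
    rw [sq, mul_assoc]
    exact Nat.mul_le_mul_left _ (hcardB B π σ h h')
  have e₁ := hB B₁ (fun t => t.1) (fun t => t.2)
    (fun t ht => by
      obtain ⟨ht, h⟩ := Finset.mem_filter.1 ht
      exact ⟨mem_squarePairs (hmem ht).1 (hmem ht).2.1 h, (hmem ht).2.2⟩)
    (fun t _ t' _ h h' => Prod.ext h h')
    (fun t _ t' _ h h' => Prod.ext h (by simpa [h] using h'))
  have e₂ := hB B₂ (fun t => (t.1.1, t.2)) (fun t => t.1.2)
    (fun t ht => by
      obtain ⟨ht, h⟩ := Finset.mem_filter.1 ht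
      exact ⟨mem_squarePairs (hmem ht).1 (hmem ht).2.2 h, (hmem ht).2.1⟩)
    (fun t _ t' _ h h' => Prod.ext (Prod.ext (Prod.ext_iff.1 h).1 h') (Prod.ext_iff.1 h).2)
    (fun t _ t' _ h h' => by
      obtain ⟨h1, h3⟩ := Prod.ext_iff.1 h
      simp only at h1 h3
      rw [h1, h3] at h'
      exact Prod.ext (Prod.ext h1 (by linear_combination h')) h3)
  have e₃ := hB B₃ (fun t => (t.1.2, t.2)) (fun t => t.1.1)
    (fun t ht => by
      obtain ⟨ht, h⟩ := Finset.mem_filter.1 ht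
      exact ⟨mem_squarePairs (hmem ht).2.1 (hmem ht).2.2 h, (hmem ht).1⟩)
    (fun t _ t' _ h h' => Prod.ext (Prod.ext h' (Prod.ext_iff.1 h).1) (Prod.ext_iff.1 h).2)
    (fun t _ t' _ h h' => by
      obtain ⟨h1, h3⟩ := Prod.ext_iff.1 h
      simp only at h1 h3
      rw [h1, h3] at h'
      exact Prod.ext (Prod.ext (by linear_combination h') h1) h3)
  have e₀ : energy A (fun p => p.1.1 + p.1.2 + p.2) ≤
      144 * Nat.card K ^ (2 * (4 * m - (r + 9 * m + 5) / 6)) * A.card := by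
    refine energy_le_of_reps_le fun g => card_triples_le h2 hφ hr hm g _ ?_ ?_
    · intro t ht
      obtain ⟨ht, hg⟩ := Finset.mem_filter.1 ht
      have := hmem (Finset.mem_filter.1 ht).1
      exact ⟨mem_shortRoots.1 this.1, mem_shortRoots.1 this.2.1, mem_shortRoots.1 this.2.2, hg⟩
    · intro t ht
      exact (Finset.mem_filter.1 (Finset.mem_filter.1 ht).1).2
  have hAcard : A.card ≤ X.card ^ 3 := by
    refine (Finset.card_filter_le _ _).trans ?_
    rw [hS, Finset.card_product, Finset.card_product]
    exact le_of_eq (by ring)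
  have e₄ := e₀.trans (Nat.mul_le_mul_left _ hAcard)
  have u₁ := energy_union_le hsub (fun p => p.1.1 + p.1.2 + p.2)
  have u₂ := energy_union_le (subset_refl (B₁ ∪ (B₂ ∪ B₃))) (fun p => p.1.1 + p.1.2 + p.2)
  have u₃ := energy_union_le (subset_refl (B₂ ∪ B₃)) (fun p => p.1.1 + p.1.2 + p.2)
  linarith

/-- The energy of the fourfold sums of elements of `X`. -/
def fourfoldEnergy (X : Finset L) : ℕ :=
  energy (((X ×ˢ X) ×ˢ X) ×ˢ X) (fun p => p.1.1.1 + p.1.1.2 + p.1.2 + p.2)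

theorem fourfoldEnergy_le_triples (X : Finset L) : fourfoldEnergy X ≤
    X.card ^ 2 * energy ((X ×ˢ X) ×ˢ X) (fun p => p.1.1 + p.1.2 + p.2) :=
  energy_product_add_le ((X ×ˢ X) ×ˢ X) (fun p => p.1.1 + p.1.2 + p.2) X

theorem fourfoldEnergy_le_pairs (X : Finset L) : fourfoldEnergy X ≤
    X.card ^ 4 * energy (X ×ˢ X) (fun p => p.1 + p.2) := by
  refine (fourfoldEnergy_le_triples X).trans ?_
  rw [show X.card ^ 4 = X.card ^ 2 * X.card ^ 2 by ring, mul_assoc]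
  exact Nat.mul_le_mul_left _ (energy_product_add_le (X ×ˢ X) (fun p => p.1 + p.2) X)

theorem fourfoldEnergy_le_trivial [Finite K] :
    fourfoldEnergy (shortRoots φ m) ≤ 128 * Nat.card K ^ (7 * m) := by
  have hX : (shortRoots φ m).card ≤ 2 * Nat.card K ^ m :=
    card_shortRoots_le (φ := φ) _ fun x hx => mem_shortRoots.1 hx
  calc _ ≤ (shortRoots φ m).card ^ 4 * (shortRoots φ m).card ^ 3 :=
        (fourfoldEnergy_le_pairs _).trans (Nat.mul_le_mul_left _ (energy_pairs_le_card_pow _))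
    _ = (shortRoots φ m).card ^ 7 := by ring
    _ ≤ (2 * Nat.card K ^ m) ^ 7 := Nat.pow_le_pow_left hX 7
    _ = _ := by ring

theorem fourfoldEnergy_le_of_four_mul_lt [Finite K] (h2 : (2 : K) ≠ 0)
    (hφ : ∀ a, φ a = 0 → a ≠ 0 → r ≤ a.natDegree) (hr : 4 * m < r) (hm : 0 < m) :
    fourfoldEnergy (shortRoots φ m) ≤
      1024 * ((m + 1) ^ 2 * Nat.card K ^ 6) * Nat.card K ^ (6 * m) := by
  have hX : (shortRoots φ m).card ≤ 2 * Nat.card K ^ m :=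
    card_shortRoots_le (φ := φ) _ fun x hx => mem_shortRoots.1 hx
  have hQ := card_squarePairs_sq_le (φ := φ) hm
  have h1 : 1 ≤ (m + 1) ^ 2 * Nat.card K ^ 6 :=
    Nat.mul_pos (pow_pos (by omega) _) (pow_pos Nat.card_pos _)
  generalize (m + 1) ^ 2 * Nat.card K ^ 6 = M at *
  calc _ ≤ (shortRoots φ m).card ^ 4 *
        (8 * (shortRoots φ m).card ^ 2 + 2 * (squarePairs φ m).card ^ 2) :=
        (fourfoldEnergy_le_pairs _).trans (Nat.mul_le_mul_left _ (energy_pairs_le h2 hφ hr))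
    _ ≤ (2 * Nat.card K ^ m) ^ 4 *
        (8 * (2 * Nat.card K ^ m) ^ 2 + 2 * (16 * M * Nat.card K ^ (2 * m))) := by gcongr
    _ = 512 * (1 + M) * Nat.card K ^ (6 * m) := by ring
    _ ≤ _ := Nat.mul_le_mul_right _ (by omega)

theorem fourfoldEnergy_le_of_twelve_mul_le [Finite K] (h2 : (2 : K) ≠ 0)
    (hφ : ∀ a, φ a = 0 → a ≠ 0 → r ≤ a.natDegree) (hr : 12 * m ≤ r) (hm : 0 < m) :
    fourfoldEnergy (shortRoots φ m) ≤ 12000 * ((m + 1) ^ 2 * Nat.card K ^ 6) *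
      (Nat.card K ^ (5 * m) * Nat.card K ^ (2 * (4 * m - (r + 9 * m + 5) / 6))) := by
  have hX : (shortRoots φ m).card ≤ 2 * Nat.card K ^ m :=
    card_shortRoots_le (φ := φ) _ fun x hx => mem_shortRoots.1 hx
  have hQ := card_squarePairs_sq_le (φ := φ) hm
  have h1 : 1 ≤ (m + 1) ^ 2 * Nat.card K ^ 6 :=
    Nat.mul_pos (pow_pos (by omega) _) (pow_pos Nat.card_pos _)
  have hT := energy_triples_le h2 hφ hr hm
  have h3 : 1 ≤ Nat.card K ^ (2 * (4 * m - (r + 9 * m + 5) / 6)) := pow_pos Nat.card_pos _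
  generalize (m + 1) ^ 2 * Nat.card K ^ 6 = M at *
  generalize Nat.card K ^ (2 * (4 * m - (r + 9 * m + 5) / 6)) = B at *
  calc _ ≤ (shortRoots φ m).card ^ 2 * (288 * B * (shortRoots φ m).card ^ 3 +
        20 * ((squarePairs φ m).card ^ 2 * (shortRoots φ m).card)) :=
        (fourfoldEnergy_le_triples _).trans (Nat.mul_le_mul_left _ hT)
    _ ≤ (2 * Nat.card K ^ m) ^ 2 * (288 * B * (2 * Nat.card K ^ m) ^ 3 +
        20 * ((16 * M * Nat.card K ^ (2 * m)) * (2 * Nat.card K ^ m))) := by gcongr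
    _ = (9216 * B + 2560 * M) * Nat.card K ^ (5 * m) := by ring
    _ ≤ (12000 * M * B) * Nat.card K ^ (5 * m) := Nat.mul_le_mul_right _ (by nlinarith)
    _ = _ := by ring

end Bounds

/-! ### Return to polynomials, and comparison of exponents -/

section Final

/-- Reduction modulo `F` is injective on polynomials of degree below `deg F`. -/
theorem ncard_le_fourfoldEnergy {K L : Type*} [Field K] [Field L] [Fintype L] [DecidableEq L]
    (φ : K[X] →+* L) {F : K[X]} (hF : F ≠ 0) (hφ : ∀ a b, φ a = φ b ↔ a % F = b % F) (m : ℕ) :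
    Set.ncard {x : Fin (2 * 4) → K[X] | ((∀ i, x i ∈ shortPolys K F.natDegree) ∧
      φ (∑ i with i.val < 4, x i) = φ (∑ i with 4 ≤ i.val, x i)) ∧
        ∀ i, degMod F (x i ^ 2) < (m : WithBot ℕ)} ≤ fourfoldEnergy (shortRoots φ m) := by
  classical
  rw [fourfoldEnergy, ← card_filter_product_eq_energy, ← Set.ncard_coe_finset]
  refine Set.ncard_le_ncard_of_injOn
    (fun x => ((((φ (x 0), φ (x 1)), φ (x 2)), φ (x 3)), (((φ (x 4), φ (x 5)), φ (x 6)), φ (x 7))))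
    ?_ ?_ (Finset.finite_toSet _)
  · rintro x ⟨⟨-, hsum⟩, hx⟩
    have hmem : ∀ i, φ (x i) ∈ shortRoots φ m := by
      intro i
      refine mem_shortRoots.2 ⟨x i ^ 2 % F, hx i, ?_⟩
      rw [← map_pow, hφ, (mod_eq_self_iff hF).2 (degree_mod_lt _ hF)]
    have h1 : (Finset.univ.filter fun i : Fin (2 * 4) => i.val < 4) = {0, 1, 2, 3} := by decide
    have h2 : (Finset.univ.filter fun i : Fin (2 * 4) => 4 ≤ i.val) = {4, 5, 6, 7} := by decide
    rw [h1, h2] at hsum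
    simp only [Finset.coe_filter, Finset.mem_product, Set.mem_ofPred_eq, hmem, and_self, true_and]
    simpa [add_assoc] using hsum
  · rintro x ⟨⟨hx, -⟩, -⟩ y ⟨⟨hy, -⟩, -⟩ h
    have hinj : ∀ i, φ (x i) = φ (y i) → x i = y i := by
      intro i hi
      have hd := degree_eq_natDegree hF
      have hxi : (x i).degree < F.natDegree := hx i
      have hyi : (y i).degree < F.natDegree := hy i
      rw [← hd] at hxi hyi
      rw [hφ, (mod_eq_self_iff hF).2 hxi, (mod_eq_self_iff hF).2 hyi] at hi
      exact hi
    simp only [Prod.mk.injEq] at h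
    obtain ⟨⟨⟨⟨h0, h1⟩, h2⟩, h3⟩, ⟨⟨h4, h5⟩, h6⟩, h7⟩ := h
    funext i
    fin_cases i
    · exact hinj _ h0
    · exact hinj _ h1
    · exact hinj _ h2
    · exact hinj _ h3
    · exact hinj _ h4
    · exact hinj _ h5
    · exact hinj _ h6
    · exact hinj _ h7

theorem finite_residues {K : Type*} [Field K] [Finite K] {F : K[X]} (hF : F ≠ 0) :
    Finite (Residues F) := by
  have := (finite_shortPolys K F.natDegree).to_subtype
  refine Finite.of_surjective (fun x : shortPolys K F.natDegree => residue F x.1) fun y => ?_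
  obtain ⟨a, rfl⟩ := Ideal.Quotient.mk_surjective y
  refine ⟨⟨a % F, ?_⟩, ?_⟩
  · change (a % F).degree < F.natDegree
    rw [← degree_eq_natDegree hF]
    exact degree_mod_lt a hF
  · rw [residue_eq_iff, (mod_eq_self_iff hF).2 (degree_mod_lt _ hF)]

theorem le_natDegree_of_residue_eq_zero {K : Type*} [Field K] {F a : K[X]} (h : residue F a = 0)
    (ha : a ≠ 0) : F.natDegree ≤ a.natDegree := by
  rw [Ideal.Quotient.eq_zero_iff_mem, Ideal.mem_span_singleton] at h
  exact natDegree_le_of_dvd h ha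

/-- The integral form of the bound for the energy. -/
theorem sqrtEnergy_le {K : Type*} [Field K] [Finite K] (h2 : (2 : K) ≠ 0) {F : K[X]}
    (hF : Irreducible F) (m : ℕ) : ∃ E : ℕ, sqrtEnergy F 4 (shortWeight ℝ F m) = E ∧
      E ≤ 128 * Nat.card K ^ (7 * m) ∧
      (4 * m < F.natDegree → 0 < m →
        E ≤ 1024 * ((m + 1) ^ 2 * Nat.card K ^ 6) * Nat.card K ^ (6 * m)) ∧
      (12 * m ≤ F.natDegree → 0 < m → E ≤ 12000 * ((m + 1) ^ 2 * Nat.card K ^ 6) *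
        (Nat.card K ^ (5 * m) *
          Nat.card K ^ (2 * (4 * m - (F.natDegree + 9 * m + 5) / 6)))) := by
  classical
  have hmax : (Ideal.span {F}).IsMaximal := PrincipalIdealRing.isMaximal_of_irreducible hF
  let := Ideal.Quotient.field (Ideal.span {F})
  have := finite_residues hF.ne_zero
  let := Fintype.ofFinite (Residues F)
  have hle := ncard_le_fourfoldEnergy (residue F) hF.ne_zero (residue_eq_iff F) m
  refine ⟨_, sqrtEnergy_shortWeight ℝ F 4 m, hle.trans fourfoldEnergy_le_trivial,
    fun hr hm => hle.trans ?_, fun hr hm => hle.trans ?_⟩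
  · exact fourfoldEnergy_le_of_four_mul_lt h2 (fun a => le_natDegree_of_residue_eq_zero) hr hm
  · exact fourfoldEnergy_le_of_twelve_mul_le h2 (fun a => le_natDegree_of_residue_eq_zero) hr hm

theorem isLittleO_logb_const_mul_sq (b : ℝ) {A : ℝ} (hA : 0 < A) :
    (fun m : ℕ => Real.logb b (A * ((m : ℝ) + 1) ^ 2)) =o[atTop] fun m : ℕ => (m : ℝ) := by
  have h1 : (fun m : ℕ => Real.logb b (A * ((m : ℝ) + 1) ^ 2)) = fun m : ℕ =>
      (Real.log b)⁻¹ * (Real.log A + 2 * Real.log ((m : ℝ) + 1)) := by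
    funext m
    have hm : ((m : ℝ) + 1) ≠ 0 := by positivity
    rw [Real.logb, Real.log_mul hA.ne' (pow_ne_zero 2 hm), Real.log_pow]
    push_cast
    ring
  rw [h1]
  refine IsLittleO.const_mul_left (IsLittleO.add ?_ (IsLittleO.const_mul_left ?_ _)) _
  · exact isLittleO_const_left.2 (Or.inr
      (tendsto_norm_atTop_atTop.comp tendsto_natCast_atTop_atTop))
  · have h3 : Tendsto (fun m : ℕ => (m : ℝ) + 1) atTop atTop :=
      tendsto_atTop_add_const_right _ _ tendsto_natCast_atTop_atTop
    refine (Real.isLittleO_log_id_atTop.comp_tendsto h3).trans_isBigO ?_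
    refine IsBigO.of_bound 2 (eventually_atTop.2 ⟨1, fun m hm => ?_⟩)
    have hm' : (1 : ℝ) ≤ m := by exact_mod_cast hm
    simp only [Function.comp_apply, id_eq]
    rw [Real.norm_of_nonneg (by positivity), Real.norm_of_nonneg (by positivity)]
    linarith

/-- The three bounds fit exactly: `7m ≤ 23m/2 - r/2` means `r ≤ 9m`; `6m ≤ 9m - r/4` means `r ≤
12m`; and `10m - r/3 ≤ 9m - r/4` means `r ≥ 12m`. -/
theorem bound_of_integral_bounds {q : ℕ} (hq : 1 < q) {E r m : ℕ}
    (h₁ : E ≤ 128 * q ^ (7 * m))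
    (h₂ : 4 * m < r → 0 < m → E ≤ 1024 * ((m + 1) ^ 2 * q ^ 6) * q ^ (6 * m))
    (h₃ : 12 * m ≤ r → 0 < m → E ≤ 12000 * ((m + 1) ^ 2 * q ^ 6) *
      (q ^ (5 * m) * q ^ (2 * (4 * m - (r + 9 * m + 5) / 6)))) :
    (E : ℝ) ≤ (12000 * (q : ℝ) ^ 6 * ((m : ℝ) + 1) ^ 2) * ((q : ℝ) ^ (6 * (m : ℝ)) *
      ((q : ℝ) ^ (11 * (m : ℝ) / 2 - (r : ℝ) / 2) + (q : ℝ) ^ (3 * (m : ℝ) - (r : ℝ) / 4) +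
        (q : ℝ) ^ (5 * (m : ℝ) / 8 - (r : ℝ) / 8)) + (q : ℝ) ^ (5 * (m : ℝ))) := by
  have hq1 : (1 : ℝ) ≤ q := by exact_mod_cast hq.le
  have hq0 : (0 : ℝ) < q := by linarith
  have hpos : ∀ x : ℝ, 0 < (q : ℝ) ^ x := fun x => Real.rpow_pos_of_pos hq0 x
  obtain ⟨M, hM⟩ : ∃ M : ℝ, M = 12000 * (q : ℝ) ^ 6 * ((m : ℝ) + 1) ^ 2 := ⟨_, rfl⟩
  have hM1 : 12000 ≤ M := by
    have h1 : (1 : ℝ) ≤ (q : ℝ) ^ 6 := one_le_pow₀ hq1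
    have h3 : (1 : ℝ) ≤ ((m : ℝ) + 1) ^ 2 := one_le_pow₀ (by linarith [Nat.cast_nonneg (α := ℝ) m])
    rw [hM]
    nlinarith
  rw [← hM, mul_add ((q : ℝ) ^ (6 * (m : ℝ))), mul_add ((q : ℝ) ^ (6 * (m : ℝ))),
    ← Real.rpow_add hq0, ← Real.rpow_add hq0, ← Real.rpow_add hq0]
  have main : ∀ x : ℝ, (E : ℝ) ≤ M * (q : ℝ) ^ x →
      (x ≤ 6 * (m : ℝ) + (11 * (m : ℝ) / 2 - (r : ℝ) / 2) ∨
        x ≤ 6 * (m : ℝ) + (3 * (m : ℝ) - (r : ℝ) / 4) ∨ x ≤ 5 * (m : ℝ)) →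
      (E : ℝ) ≤ M * ((q : ℝ) ^ (6 * (m : ℝ) + (11 * (m : ℝ) / 2 - (r : ℝ) / 2)) +
        (q : ℝ) ^ (6 * (m : ℝ) + (3 * (m : ℝ) - (r : ℝ) / 4)) +
        (q : ℝ) ^ (6 * (m : ℝ) + (5 * (m : ℝ) / 8 - (r : ℝ) / 8)) + (q : ℝ) ^ (5 * (m : ℝ))) := by
    intro x hx hcases
    refine hx.trans (mul_le_mul_of_nonneg_left ?_ (by linarith))
    have p1 := hpos (6 * (m : ℝ) + (11 * (m : ℝ) / 2 - (r : ℝ) / 2))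
    have p2 := hpos (6 * (m : ℝ) + (3 * (m : ℝ) - (r : ℝ) / 4))
    have p3 := hpos (6 * (m : ℝ) + (5 * (m : ℝ) / 8 - (r : ℝ) / 8))
    have p4 := hpos (5 * (m : ℝ))
    rcases hcases with h | h | h
    · have := Real.rpow_le_rpow_of_exponent_le hq1 h
      linarith
    · have := Real.rpow_le_rpow_of_exponent_le hq1 h
      linarith
    · have := Real.rpow_le_rpow_of_exponent_le hq1 h
      linarith
  have hcast : ∀ n : ℕ, (q : ℝ) ^ (n : ℝ) = ((q ^ n : ℕ) : ℝ) := fun n => by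
    rw [Real.rpow_natCast, Nat.cast_pow]
  have hM' : M = ((12000 * ((m + 1) ^ 2 * q ^ 6) : ℕ) : ℝ) := by
    rw [hM]
    push_cast
    ring
  have e₁ : (E : ℝ) ≤ M * (q : ℝ) ^ ((7 * m : ℕ) : ℝ) := by
    rw [hcast]
    have : (E : ℝ) ≤ 128 * ((q ^ (7 * m) : ℕ) : ℝ) := by exact_mod_cast h₁
    refine this.trans (mul_le_mul_of_nonneg_right (by linarith) (Nat.cast_nonneg _))
  rcases Nat.eq_zero_or_pos m with hm | hm
  · subst hm
    exact main _ e₁ (Or.inr (Or.inr (by simp)))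
  rcases Nat.lt_or_ge (9 * m) r with hr | hr
  · rcases Nat.lt_or_ge r (12 * m) with hr' | hr'
    · refine main ((6 * m : ℕ) : ℝ) ?_ (Or.inr (Or.inl ?_))
      · rw [hcast, hM', ← Nat.cast_mul, Nat.cast_le]
        exact (h₂ (by omega) hm).trans (Nat.mul_le_mul_right _ (Nat.mul_le_mul_right _ (by norm_num)))
      · have : (r : ℝ) ≤ 12 * m := by exact_mod_cast hr'.le
        push_cast
        linarith
    · refine main ((5 * m + 2 * (4 * m - (r + 9 * m + 5) / 6) : ℕ) : ℝ) ?_ (Or.inr ?_)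
      · rw [hcast, hM', ← Nat.cast_mul, Nat.cast_le, pow_add]
        exact h₃ hr' hm
      -- When the truncated difference vanishes, the term `q^(5m)` suffices. Otherwise the exponent
      -- is at most `10m - r/3`.
      · rcases Nat.eq_zero_or_pos (4 * m - (r + 9 * m + 5) / 6) with h0 | h0
        · right
          rw [h0]
          push_cast
          linarith
        · left
          have h4 : 3 * (2 * (4 * m - (r + 9 * m + 5) / 6)) + r ≤ 15 * m := by omega
          have h4' : 3 * ((2 * (4 * m - (r + 9 * m + 5) / 6) : ℕ) : ℝ) + r ≤ 15 * m := by
            exact_mod_cast h4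
          have h5 : (12 : ℝ) * m ≤ r := by exact_mod_cast hr'
          rw [Nat.cast_add]
          push_cast at h4' ⊢
          linarith
  · refine main _ e₁ (Or.inl ?_)
    have : (r : ℝ) ≤ 9 * m := by exact_mod_cast hr
    push_cast
    linarith

end Final

end ModularRoots

theorem theorem2p7 (Fq : Type*) [Field Fq] [Fintype Fq] (hq : Odd (Fintype.card Fq)) :
    (∃ f : ℕ → ℝ, f =o[atTop] (fun m : ℕ => (m : ℝ)) ∧
      ∀ (r m : ℕ) (F : Fq[X]), Irreducible F → F.natDegree = r → m ≤ r →
        ModularRoots.sqrtEnergy F 4 (ModularRoots.shortWeight ℝ F m) ≤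
          (Fintype.card Fq : ℝ) ^ (6 * (m : ℝ) + f m) *
            ((Fintype.card Fq : ℝ) ^ (11 * (m : ℝ) / 2 - (r : ℝ) / 2) +
              (Fintype.card Fq : ℝ) ^ (3 * (m : ℝ) - (r : ℝ) / 4) +
              (Fintype.card Fq : ℝ) ^ (5 * (m : ℝ) / 8 - (r : ℝ) / 8)) +
          (Fintype.card Fq : ℝ) ^ (5 * (m : ℝ) + f m)) ∧
    (∀ r m : ℕ, 0 < m → (m : ℝ) < (r : ℝ) / 12 →
      max (6 * (m : ℝ) + max (11 * (m : ℝ) / 2 - (r : ℝ) / 2)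
            (max (3 * (m : ℝ) - (r : ℝ) / 4) (5 * (m : ℝ) / 8 - (r : ℝ) / 8)))
          (5 * (m : ℝ)) <
        4 * (m : ℝ) + max (7 * (m : ℝ) / 2 - (r : ℝ) / 2) (2 * (m : ℝ))) := by
  constructor
  · have hq1 : 1 < Fintype.card Fq := Fintype.one_lt_card
    have hq0 : (0 : ℝ) < Fintype.card Fq := by exact_mod_cast hq1.le
    have hqne : (Fintype.card Fq : ℝ) ≠ 1 := by exact_mod_cast hq1.ne'
    have h2 : (2 : Fq) ≠ 0 := by
      refine Ring.two_ne_zero fun h => ?_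
      exact Nat.not_even_iff_odd.2 hq (Nat.even_iff.2 (FiniteField.even_card_iff_char_two.1 h))
    -- All polynomial factors and constants become a single power of `q` with a logarithmic
    -- exponent; `m + 1` keeps this valid at `m = 0`.
    refine ⟨fun m => Real.logb (Fintype.card Fq)
      (12000 * (Fintype.card Fq : ℝ) ^ 6 * ((m : ℝ) + 1) ^ 2),
      ModularRoots.isLittleO_logb_const_mul_sq _ (by positivity), fun r m F hF hr _ => ?_⟩
    obtain ⟨E, hE, h₁, h₂, h₃⟩ := ModularRoots.sqrtEnergy_le h2 hF m
    rw [hr, Nat.card_eq_fintype_card] at *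
    rw [hE]
    refine (ModularRoots.bound_of_integral_bounds hq1 h₁ h₂ h₃).trans (le_of_eq ?_)
    rw [Real.rpow_add hq0, Real.rpow_add hq0,
      Real.rpow_logb hq0 hqne (by positivity)]
    ring
  · intro r m hm hmr
    have hm' : (0 : ℝ) < m := by exact_mod_cast hm
    have h1 := le_max_right (7 * (m : ℝ) / 2 - (r : ℝ) / 2) (2 * (m : ℝ))
    refine lt_of_lt_of_le ?_ (add_le_add_right h1 _)
    rw [max_lt_iff]
    refine ⟨?_, by linarith⟩
    -- All three exponents are negative for `m < r/12`, so the left side is below `6m = 4m + 2m`.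
    have h3 : max (11 * (m : ℝ) / 2 - (r : ℝ) / 2)
        (max (3 * (m : ℝ) - (r : ℝ) / 4) (5 * (m : ℝ) / 8 - (r : ℝ) / 8)) < 0 :=
      max_lt (by linarith) (max_lt (by linarith) (by linarith))
    linarith
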